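/- Let $n\ge 0$ be an integer and let $p,q,a,b,c,d,e$ be complex numbers with $|p|<1$, $q\neq 0$, $a\neq 0$. Put $$E(x)=E(x;p)=\prod_{k\ge 0}(1-xp^k)\prod_{k\ge 0}(1-p^{k+1}/x),\qquad (x;q,p)_k=\prod_{j=0}^{k-1}E(xq^j),$$ $(x_1,\dots,x_m;q,p)_k=(x_1;q,p)_k\cdots(x_m;q,p)_k$, and $${_{r+1}\omega_r}(a_1;a_4,\dots,a_{r+1};q,p)=\sum_{k=0}^{\infty}\frac{E(a_1q^{2k})}{E(a_1)}\,\frac{(a_1,a_4,\dots,a_{r+1};q,p)_k\,q^k}{(q,a_1q/a_4,\dots,a_1q/a_{r+1};q,p)_k}.$$ If some $a_i$ ($i\ge 4$) equals $q^{-m}$ with $m$ a nonnegative integer, the series terminates and is understood as the sum over $0\le k\le m$. Suppose that $bc=a^2q^{n+1}$ and $de=aq^{n+1}$, and that none of the denominators in the identity below vanishes (in the series on the right, which has base $q^3$ and terminates after the term $k=\lfloor n/3\rfloor$, only the terms with $0\le k\le\lfloor n/3\rfloor$ are concerned). Then $$\sum_{k=0}^{\lfloor n/2\rfloor}\frac{E(aq^{4k})}{E(a)}\,\frac{(b,c;q^3,p)_k}{(aq/b,aq/c;q,p)_k}\,\frac{(q^{-n};q,p)_{2k}}{(aq^{n+1};q,p)_{2k}}\,\frac{(d,e;q,p)_k}{(aq^3/d,aq^3/e;q^3,p)_k}\,q^k$$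 $$=\frac{(aq;q,p)_n\,(aq^{2-n}/b;q^3,p)_n}{(aq/b;q,p)_n\,(aq^{2-n};q^3,p)_n}\;{_{10}\omega_9}(a^2/de;\,b,c,a/d,a/e,q^{2-n},q^{1-n},q^{-n};\,q^3,p).$$ -/

import Mathlib

noncomputable section

/-- The theta function `E(x; p) = (x; p)_∞ (p / x; p)_∞`, for `x ≠ 0` and `|p| < 1`. -/
def ellE (x p : ℂ) : ℂ :=
  (∏' k : ℕ, (1 - x * p ^ k)) * ∏' k : ℕ, (1 - p / x * p ^ k)

/-- Both infinite products defining `ellE` converge when `|p| < 1`. -/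
theorem multipliable_ellE_factor (x : ℂ) {p : ℂ} (hp : ‖p‖ < 1) :
    Multipliable fun k : ℕ => 1 - x * p ^ k := by
  have h : Summable fun k : ℕ => ‖-(x * p ^ k)‖ := by
    simp only [norm_neg, norm_mul, norm_pow]
    exact (summable_geometric_of_lt_one (norm_nonneg p) hp).mul_left _
  simpa [sub_eq_add_neg] using multipliable_one_add_of_summable h

/-- The elliptic shifted factorial `(a; q, p)_n = ∏_{k < n} E(a q^k; p)`. -/
def ellFac (a q p : ℂ) (n : ℕ) : ℂ :=
  ∏ k ∈ Finset.range n, ellE (a * q ^ k) p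

/-- The condensed notation `(a₁, …, a_m; q, p)_n = (a₁; q, p)_n ⋯ (a_m; q, p)_n`. -/
def ellFacs (as : List ℂ) (q p : ℂ) (n : ℕ) : ℂ :=
  (as.map fun a => ellFac a q p n).prod

/-- The denominator factorial `(q, a₁ q / a₄, …, a₁ q / a_{r+1}; q, p)_k` of the `k`-th term of
`_{r+1}ω_r(a₁; a₄, …, a_{r+1}; q, p)`; the list `as` is `[a₄, …, a_{r+1}]`. -/
def ellOmegaDen (a₁ : ℂ) (as : List ℂ) (q p : ℂ) (k : ℕ) : ℂ :=
  ellFacs (q :: as.map fun x => a₁ * q / x) q p k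

/-- The `k`-th term of `_{r+1}ω_r(a₁; a₄, …, a_{r+1}; q, p)`. -/
def ellOmegaTerm (a₁ : ℂ) (as : List ℂ) (q p : ℂ) (k : ℕ) : ℂ :=
  ellE (a₁ * q ^ (2 * k)) p / ellE a₁ p *
    (ellFacs (a₁ :: as) q p k * q ^ k / ellOmegaDen a₁ as q p k)

/-- The very-well-poised elliptic hypergeometric series
`_{r+1}ω_r(a₁; a₄, …, a_{r+1}; q, p)`, where the list `as` is `[a₄, …, a_{r+1}]`. -/
def ellOmega (a₁ : ℂ) (as : List ℂ) (q p : ℂ) : ℂ :=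
  ∑' k : ℕ, ellOmegaTerm a₁ as q p k

theorem ellE_one (p : ℂ) : ellE 1 p = 0 := by
  have h : (∏' k : ℕ, (1 - (1 : ℂ) * p ^ k)) = 0 :=
    tprod_of_exists_eq_zero ⟨0, by simp⟩
  rw [ellE, h, zero_mul]

/-- If one of the upper parameters `x` is `q^{-m}`, the series terminates: it is the finite sum of
its terms with `k ≤ m`. -/
theorem ellOmega_eq_sum_of_terminating (a₁ : ℂ) (as : List ℂ) (q p x : ℂ) (m : ℕ)
    (hx : x ∈ as) (hxm : x * q ^ m = 1) :
    ellOmega a₁ as q p = ∑ k ∈ Finset.range (m + 1), ellOmegaTerm a₁ as q p k := by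
  refine tsum_eq_sum fun k hk => ?_
  have hmk : m < k := by
    rw [Finset.mem_range] at hk
    omega
  have h0 : ellFac x q p k = 0 :=
    Finset.prod_eq_zero (Finset.mem_range.2 hmk) (by rw [hxm, ellE_one])
  have h1 : ellFacs (a₁ :: as) q p k = 0 :=
    List.prod_eq_zero (List.mem_map.2 ⟨x, List.mem_cons_of_mem a₁ hx, h0⟩)
  simp [ellOmegaTerm, h1]

end

/-! Put `x = e^u` and replace `E` by the odd function `s(u) = e^{-u/2} E(e^u; p)`. The two balancing
conditions make all exponential prefactors cancel, so the identity becomes one about products of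
values of `s` along arithmetic progressions. Its algebra uses only oddness and the Weierstrass
three-term relation (`IsThetaLike`). That relation comes from the Jacobi triple product: multiplying
two theta series shows that `s(x+y) s(x-y)` is a kernel of rank at most two, and an antisymmetric
kernel of this kind satisfies the Plücker relation (`isThetaLike_symTheta`).

The transformation rests on a summable special case, `d = a`, `e = q^(n+1)` (`cubic_sum`). It is a
binomial theorem in disguise (`cubic_binomial`): a product is built up factor by factor, the
three-term relation splits each new factor into two, and the coefficients obey a Pascal rule
(`cubicCoeff_pascal`).

For general `d, e`, the factor of the summand containing them is expanded in elliptic partial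
fractions (`cubicDE_eq_sum`). With `k = j + i`, the `j`-th coefficient times the rest of the summand
is, as a function of `i`, a summand of the special case with `a, b, c, n` replaced by `a q^(4j), b
q^(3j), c q^(3j), n - 2j`. Interchanging the sums and evaluating the inner one leaves a single sum
over `j`, whose terms are those of the very-well-poised series (`cubic_factorization`).

The argument divides by quantities that the theorem allows to vanish, so it is carried out for
generic parameters. The zeros of `s` are countable, hence generic parameters exist arbitrarily close
to the given ones on a suitable real curve, and continuity gives the rest
(`cubic_transformation_of_continuous`). -/

open Filter Topology

/-! ### The Jacobi triple product -/

/-- The Gaussian binomial coefficient `[m choose j]_p`, defined by its Pascal recursion. -/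
def gaussBinom (p : ℂ) : ℕ → ℕ → ℂ
  | _, 0 => 1
  | 0, _ + 1 => 0
  | m + 1, j + 1 => gaussBinom p m j + p ^ (j + 1) * gaussBinom p m (j + 1)

theorem gaussBinom_zero_right (p : ℂ) (m : ℕ) : gaussBinom p m 0 = 1 := by
  cases m <;> rfl

theorem gaussBinom_eq_zero (p : ℂ) : ∀ {m j : ℕ}, m < j → gaussBinom p m j = 0
  | 0, j + 1, _ => rfl
  | m + 1, j + 1, h => by
    rw [gaussBinom, gaussBinom_eq_zero p (by omega : m < j),
      gaussBinom_eq_zero p (by omega : m < j + 1)]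
    simp

/-- The finite product `(p; p)_m`. -/
def eulerProd (p : ℂ) (m : ℕ) : ℂ := ∏ i ∈ Finset.range m, (1 - p ^ (i + 1))

theorem eulerProd_succ (p : ℂ) (m : ℕ) :
    eulerProd p (m + 1) = eulerProd p m * (1 - p ^ (m + 1)) := Finset.prod_range_succ _ _

theorem one_sub_pow_ne_zero {p : ℂ} (hp : ‖p‖ < 1) (i : ℕ) : 1 - p ^ (i + 1) ≠ 0 := by
  intro h
  have h1 : ‖p ^ (i + 1)‖ < 1 := by
    rw [norm_pow]
    exact pow_lt_one₀ (norm_nonneg p) hp (Nat.succ_ne_zero i)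
  rw [← sub_eq_zero.1 h, norm_one] at h1
  exact lt_irrefl _ h1

theorem eulerProd_ne_zero {p : ℂ} (hp : ‖p‖ < 1) (m : ℕ) : eulerProd p m ≠ 0 :=
  Finset.prod_ne_zero_iff.2 fun i _ => one_sub_pow_ne_zero hp i

/-- Pascal's rule together with `1 - p^(i+j+2) = (1 - p^(j+1)) + p^(j+1) (1 - p^(i+1))`. The product
form avoids division, so `p` may be a root of unity. -/
theorem gaussBinom_mul (p : ℂ) : ∀ i j : ℕ,
    gaussBinom p (i + j) j * (eulerProd p j * eulerProd p i) = eulerProd p (i + j)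
  | i, 0 => by simp [gaussBinom_zero_right, eulerProd]
  | 0, j + 1 => by
    have h := gaussBinom_mul p 0 j
    rw [zero_add] at h ⊢
    rw [gaussBinom, gaussBinom_eq_zero p (Nat.lt_succ_self j), eulerProd_succ]
    linear_combination (1 - p ^ (j + 1)) * h
  | i + 1, j + 1 => by
    have h1 := gaussBinom_mul p (i + 1) j
    have h2 := gaussBinom_mul p i (j + 1)
    have e1 : i + 1 + (j + 1) = (i + 1 + j) + 1 := by omega
    have e2 : i + (j + 1) = i + 1 + j := by omega
    rw [e2] at h2
    rw [e1, gaussBinom, eulerProd_succ p (i + 1 + j)]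
    have s1 := eulerProd_succ p i
    have s2 := eulerProd_succ p j
    linear_combination (1 - p ^ (j + 1)) * h1 + p ^ (j + 1) * (1 - p ^ (i + 1)) * h2
      + gaussBinom p (i + 1 + j) j * eulerProd p (i + 1) * s2
      + p ^ (j + 1) * gaussBinom p (i + 1 + j) (j + 1) * eulerProd p (j + 1) * s1

/-- The `q`-binomial theorem. -/
theorem prod_one_sub_mul_pow (p : ℂ) (m : ℕ) : ∀ y : ℂ,
    ∏ k ∈ Finset.range m, (1 - y * p ^ k) =
      ∑ j ∈ Finset.range (m + 1), (-1) ^ j * p ^ (j.choose 2) * gaussBinom p m j * y ^ j := by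
  induction m with
  | zero => intro y; simp [gaussBinom]
  | succ m ih =>
    intro y
    -- The factor `k = 0` is split off, which leaves the same product at `y * p`; `u` is its
    -- expansion.
    set u : ℕ → ℂ := fun j => (-1) ^ j * p ^ (j.choose 2) * gaussBinom p m j * (y * p) ^ j with hu
    have h1 : ∏ k ∈ Finset.range (m + 1), (1 - y * p ^ k) =
        (1 - y) * ∑ j ∈ Finset.range (m + 1), u j := by
      rw [Finset.prod_range_succ', ← ih (y * p), mul_comm]
      simp [pow_succ', mul_assoc]
    have h2 : ∑ j ∈ Finset.range (m + 1), u j = 1 + ∑ j ∈ Finset.range (m + 1), u (j + 1) := by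
      rw [Finset.sum_range_succ (fun j => u (j + 1)), Finset.sum_range_succ']
      simp [hu, gaussBinom_zero_right, gaussBinom_eq_zero p (Nat.lt_succ_self m), add_comm]
    rw [h1, sub_mul, one_mul]
    nth_rewrite 1 [h2]
    rw [Finset.sum_range_succ' _ (m + 1), Finset.mul_sum, add_comm, ← sub_eq_zero]
    have h3 : ∀ j ∈ Finset.range (m + 1), (-1) ^ (j + 1) * p ^ ((j + 1).choose 2) *
        gaussBinom p (m + 1) (j + 1) * y ^ (j + 1) = u (j + 1) - y * u j := by
      intro j _
      have e : (j + 1).choose 2 = j + j.choose 2 := by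
        rw [Nat.choose_succ_succ' j 1, Nat.choose_one_right]
      simp only [hu, gaussBinom, e, pow_succ, pow_add, mul_pow]
      ring
    rw [Finset.sum_congr rfl h3, Finset.sum_sub_distrib]
    simp only [gaussBinom_zero_right, pow_zero, Nat.choose_zero_succ]
    ring

/-- Finite form of the Jacobi triple product. -/
theorem finite_triple_product {p x : ℂ} (hp : p ≠ 0) (hx : x ≠ 0) (T : ℤ → ℂ) (h0 : T 0 = 1)
    (hT : ∀ k : ℤ, T (k + 1) = -(p ^ k * x) * T k) (N : ℕ) :
    (∏ k ∈ Finset.range N, (1 - x * p ^ k)) * ∏ k ∈ Finset.range N, (1 - p / x * p ^ k) =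
      ∑ j ∈ Finset.range (2 * N + 1), gaussBinom p (2 * N) j * T (j - N) := by
  -- Up to the constant `T (-N)`, these are the monomials of the `q`-binomial theorem at `y = x
  -- p^(-N)` with `2 * N` factors.
  have hj : ∀ j : ℕ, T (j - N) =
      T (-N) * ((-1) ^ j * p ^ (j.choose 2) * (x * p ^ (-N : ℤ)) ^ j) := by
    intro j
    induction j with
    | zero => simp
    | succ j ih =>
      have e : (j + 1).choose 2 = j + j.choose 2 := by
        rw [Nat.choose_succ_succ' j 1, Nat.choose_one_right]
      have e2 : ((j + 1 : ℕ) : ℤ) - N = (j - N : ℤ) + 1 := by push_cast; ring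
      rw [e2, hT, ih, e, sub_eq_add_neg, zpow_add₀ hp, zpow_natCast]
      ring
  -- Each factor is turned over by `1 - x p^(-k-1) = -x p^(-k-1) (1 - p^(k+1) / x)`; the accumulated
  -- monomials cancel against `T (-N)`.
  have h1 : T (-N) * ∏ k ∈ Finset.range N, (1 - x * (p ^ (k + 1))⁻¹) =
      ∏ k ∈ Finset.range N, (1 - p / x * p ^ k) := by
    clear hj
    induction N with
    | zero => simp [h0]
    | succ N ih =>
      have e := hT (-(N + 1 : ℕ))
      rw [show (-((N + 1 : ℕ) : ℤ) + 1) = -N by push_cast; ring] at e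
      rw [Finset.prod_range_succ, Finset.prod_range_succ, ← ih, e, zpow_neg, zpow_natCast]
      have : p ^ (N + 1) ≠ 0 := pow_ne_zero _ hp
      field_simp
      ring
  have h2 : ∏ k ∈ Finset.range (2 * N), (1 - x * p ^ (-N : ℤ) * p ^ k) =
      (∏ k ∈ Finset.range N, (1 - x * (p ^ (k + 1))⁻¹)) *
        ∏ k ∈ Finset.range N, (1 - x * p ^ k) := by
    rw [two_mul, Finset.prod_range_add, ← Finset.prod_range_reflect]
    congr 1
    · refine Finset.prod_congr rfl fun k hk => ?_
      rw [Finset.mem_range] at hk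
      rw [mul_assoc, zpow_neg, zpow_natCast]
      congr 2
      have : p ^ N = p ^ (k + 1) * p ^ (N - 1 - k) := by rw [← pow_add]; congr 1; omega
      rw [this, mul_inv, mul_assoc, inv_mul_cancel₀ (pow_ne_zero _ hp), mul_one]
    · refine Finset.prod_congr rfl fun k _ => ?_
      rw [mul_assoc, zpow_neg, zpow_natCast, pow_add, inv_mul_cancel_left₀ (pow_ne_zero _ hp)]
  rw [← h1, mul_comm, mul_assoc, ← h2, prod_one_sub_mul_pow, Finset.mul_sum]
  refine Finset.sum_congr rfl fun j _ => ?_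
  rw [hj]
  ring

theorem exists_eulerProd_tendsto {p : ℂ} (hp : ‖p‖ < 1) :
    ∃ D : ℂ, D ≠ 0 ∧ Tendsto (eulerProd p) atTop (𝓝 D) := by
  have hs : Summable fun k : ℕ => ‖-p ^ (k + 1)‖ := by
    simp only [norm_neg, norm_pow]
    exact (summable_nat_add_iff 1).2 (summable_geometric_of_lt_one (norm_nonneg p) hp)
  refine ⟨∏' k : ℕ, (1 + -p ^ (k + 1)), ?_, ?_⟩
  · refine tprod_one_add_ne_zero_of_summable (fun i => ?_) hs
    rw [← sub_eq_add_neg]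
    exact one_sub_pow_ne_zero hp i
  · refine (multipliable_one_add_of_summable hs).tendsto_prod_tprod_nat.congr fun m => ?_
    simp only [eulerProd, sub_eq_add_neg]

/-- `eulerProd p` converges to a nonzero limit, so it and its inverse are bounded. The bound is
uniform in both indices, as dominated convergence requires. -/
theorem exists_norm_gaussBinom_le {p : ℂ} (hp : ‖p‖ < 1) :
    ∃ C : ℝ, ∀ m j, ‖gaussBinom p m j‖ ≤ C := by
  obtain ⟨D, hD, hlim⟩ := exists_eulerProd_tendsto hp
  obtain ⟨A, hA⟩ := (Metric.isBounded_range_of_tendsto _ hlim).exists_norm_le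
  obtain ⟨B, hB⟩ := (Metric.isBounded_range_of_tendsto _ (hlim.inv₀ hD)).exists_norm_le
  have hA0 : 0 ≤ A := (norm_nonneg _).trans (hA _ ⟨0, rfl⟩)
  have hB0 : 0 ≤ B := (norm_nonneg _).trans (hB _ ⟨0, rfl⟩)
  refine ⟨A * (B * B), fun m j => ?_⟩
  rcases lt_or_ge m j with h | h
  · rw [gaussBinom_eq_zero p h, norm_zero]
    positivity
  · obtain ⟨i, rfl⟩ := Nat.exists_eq_add_of_le' h
    have e : gaussBinom p (i + j) j =
        eulerProd p (i + j) * ((eulerProd p j)⁻¹ * (eulerProd p i)⁻¹) := by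
      rw [← gaussBinom_mul]
      field_simp [eulerProd_ne_zero hp i, eulerProd_ne_zero hp j]
    rw [e, norm_mul, norm_mul]
    have a1 := hA _ ⟨i + j, rfl⟩
    have b1 := hB _ ⟨j, rfl⟩
    have b2 := hB _ ⟨i, rfl⟩
    exact mul_le_mul a1 (mul_le_mul b1 b2 (norm_nonneg _) hB0) (by positivity) hA0

/-- The quotient `(p;p)_{2N} / ((p;p)_{N-k} (p;p)_{N+k})` tends to `D / (D * D)`. Truncation by
`toNat` only concerns `N < |k|`. -/
theorem tendsto_gaussBinom {p : ℂ} {D : ℂ} (hp : ‖p‖ < 1) (hD : D ≠ 0)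
    (hlim : Tendsto (eulerProd p) atTop (𝓝 D)) (k : ℤ) :
    Tendsto (fun N : ℕ => gaussBinom p (2 * N) (k + N).toNat) atTop (𝓝 D⁻¹) := by
  have h1 : Tendsto (fun N : ℕ => (k + N).toNat) atTop atTop :=
    tendsto_atTop.2 fun b => (eventually_ge_atTop (b + k.natAbs)).mono fun N hN => by omega
  have h2 : Tendsto (fun N : ℕ => (N - k).toNat) atTop atTop :=
    tendsto_atTop.2 fun b => (eventually_ge_atTop (b + k.natAbs)).mono fun N hN => by omega
  have h3 : Tendsto (fun N : ℕ => 2 * N) atTop atTop :=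
    tendsto_atTop.2 fun b => (eventually_ge_atTop b).mono fun N hN => by omega
  have h4 := (hlim.comp h3).mul (((hlim.comp h1).inv₀ hD).mul ((hlim.comp h2).inv₀ hD))
  rw [mul_inv_cancel_left₀ hD] at h4
  refine h4.congr' ((eventually_ge_atTop k.natAbs).mono fun N hN => ?_)
  have e : 2 * N = (N - k).toNat + (k + N).toNat := by omega
  simp only [Function.comp]
  rw [e, ← gaussBinom_mul]
  field_simp [eulerProd_ne_zero hp (N - k).toNat, eulerProd_ne_zero hp (k + N).toNat]

/-- The Jacobi triple product: the theta function `E(x; p)` is, up to a constant, the sum of any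
bilateral sequence `T` with `T 0 = 1` and `T (k + 1) = -p ^ k x T k`. -/
theorem ellE_mul_eq_tsum {p x D : ℂ} (hp : ‖p‖ < 1) (hp0 : p ≠ 0) (hx : x ≠ 0) (hD : D ≠ 0)
    (hlim : Tendsto (eulerProd p) atTop (𝓝 D)) (T : ℤ → ℂ) (h0 : T 0 = 1)
    (hT : ∀ k : ℤ, T (k + 1) = -(p ^ k * x) * T k) (hs : Summable T) :
    ellE x p = D⁻¹ * ∑' k : ℤ, T k := by
  obtain ⟨C, hC⟩ := exists_norm_gaussBinom_le hp
  -- The finite sum spread over `ℤ` by `k = j - N`. Terms with `k < -N` are cut off by hand, since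
  -- `toNat` would give them index `0`; terms with `k > N` vanish with the Gaussian binomial.
  set F : ℕ → ℤ → ℂ := fun N k =>
    if 0 ≤ k + N then gaussBinom p (2 * N) (k + N).toNat * T k else 0 with hF
  have hsum : ∀ N : ℕ, ∑' k : ℤ, F N k =
      (∏ k ∈ Finset.range N, (1 - x * p ^ k)) * ∏ k ∈ Finset.range N, (1 - p / x * p ^ k) := by
    intro N
    rw [finite_triple_product hp0 hx T h0 hT,
      tsum_eq_sum (s := (Finset.range (2 * N + 1)).image fun j : ℕ => (j : ℤ) - N)]
    · rw [Finset.sum_image fun a _ b _ h => by simpa using h]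
      refine Finset.sum_congr rfl fun j _ => ?_
      simp [hF]
    · intro k hk
      simp only [hF]
      split_ifs with h
      · rw [gaussBinom_eq_zero, zero_mul]
        by_contra hlt
        refine hk (Finset.mem_image.2 ⟨(k + N).toNat, Finset.mem_range.2 (by omega), by omega⟩)
      · rfl
  have hl1 : Tendsto (fun N => ∑' k : ℤ, F N k) atTop (𝓝 (∑' k : ℤ, D⁻¹ * T k)) := by
    refine tendsto_tsum_of_dominated_convergence (bound := fun k => C * ‖T k‖)
      (hs.norm.mul_left C) (fun k => ?_) (Eventually.of_forall fun N k => ?_)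
    · refine ((tendsto_gaussBinom hp hD hlim k).mul_const (T k)).congr'
        ((eventually_ge_atTop k.natAbs).mono fun N hN => ?_)
      simp only [hF]
      rw [if_pos (by omega)]
    · simp only [hF]
      split_ifs
      · rw [norm_mul]
        exact mul_le_mul_of_nonneg_right (hC _ _) (norm_nonneg _)
      · rw [norm_zero]
        exact mul_nonneg ((norm_nonneg _).trans (hC 0 0)) (norm_nonneg _)
  have hl2 : Tendsto (fun N => ∑' k : ℤ, F N k) atTop (𝓝 (ellE x p)) := by
    simp only [hsum]
    exact (multipliable_ellE_factor x hp).tendsto_prod_tprod_nat.mul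
      (multipliable_ellE_factor (p / x) hp).tendsto_prod_tprod_nat
  rw [tendsto_nhds_unique hl2 hl1, tsum_mul_left]

/-! ### The odd theta function and its three-term relation -/

/-- The symmetric form `e^{-z/2} E(e^z; p)` of the theta function. -/
noncomputable def symTheta (p z : ℂ) : ℂ := Complex.exp (-z / 2) * ellE (Complex.exp z) p

theorem ellE_exp (p z : ℂ) : ellE (Complex.exp z) p = Complex.exp (z / 2) * symTheta p z := by
  rw [symTheta, ← mul_assoc, ← Complex.exp_add]
  ring_nf
  simp

/-- An odd function satisfying the three-term (Weierstrass) relation. -/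
structure IsThetaLike (s : ℂ → ℂ) : Prop where
  neg : ∀ x, s (-x) = -s x
  three_term : ∀ x y z w, s (x + y) * s (x - y) * (s (z + w) * s (z - w))
    - s (x + z) * s (x - z) * (s (y + w) * s (y - w))
    + s (x + w) * s (x - w) * (s (y + z) * s (y - z)) = 0

theorem tprod_one_sub_eq {p : ℂ} (hp : ‖p‖ < 1) (x : ℂ) :
    ∏' k : ℕ, (1 - x * p ^ k) = (1 - x) * ∏' k : ℕ, (1 - x * p * p ^ k) := by
  have h1 := (multipliable_ellE_factor (x * p) hp).tendsto_prod_tprod_nat.const_mul (1 - x)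
  have h2 := (tendsto_add_atTop_iff_nat 1).2
    (multipliable_ellE_factor x hp).tendsto_prod_tprod_nat
  refine tendsto_nhds_unique h2 (h1.congr fun n => ?_)
  rw [Finset.prod_range_succ', mul_comm]
  simp [pow_succ', mul_assoc]

theorem ellE_inv {p x : ℂ} (hp : ‖p‖ < 1) (hx : x ≠ 0) : ellE x⁻¹ p = -(ellE x p / x) := by
  have e1 : p / x⁻¹ = x * p := by field_simp
  have e2 : x⁻¹ * p = p / x := by field_simp
  rw [ellE, ellE, tprod_one_sub_eq hp x, tprod_one_sub_eq hp x⁻¹, e1, e2]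
  field_simp
  ring

theorem symTheta_neg {p : ℂ} (hp : ‖p‖ < 1) (z : ℂ) : symTheta p (-z) = -symTheta p z := by
  have h : Complex.exp (- -z / 2) = Complex.exp (-z / 2) * Complex.exp z := by
    rw [← Complex.exp_add]; ring_nf
  rw [symTheta, symTheta, Complex.exp_neg, ellE_inv hp (Complex.exp_ne_zero z), h]
  field_simp

/-- An antisymmetric kernel of rank at most two satisfies the Plücker relation. -/
theorem plucker_of_rank_two {K ι : Type*} [Field K] {h : ι → ι → K} {f₀ g₀ f₁ g₁ : ι → K}
    (hr : ∀ x y, h x y = f₀ x * g₀ y + f₁ x * g₁ y) (ha : ∀ x y, h y x = -h x y)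
    (hd : ∀ x, h x x = 0) (x y z w : ι) : h x y * h z w - h x z * h y w + h x w * h y z = 0 := by
  have key : ∀ x y z w, h x y * (h x y * h z w - h x z * h y w + h x w * h y z) = 0 := by
    intro x y z w
    -- The 3×3 minor with rows `x, y, z` and columns `x, y, w` vanishes by rank two; antisymmetry
    -- turns it into `h x y` times the Plücker expression.
    have minor : h x x * (h y y * h z w - h y w * h z y) - h x y * (h y x * h z w - h y w * h z x)
        + h x w * (h y x * h z y - h y y * h z x) = 0 := by
      simp only [hr]; ring
    rw [hd, hd, ha x y, ha x z, ha y z] at minor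
    linear_combination minor
  have k1 := key x y z w
  have k2 := key x z y w
  have k3 := key x w y z
  rw [ha y z] at k2
  rw [ha y w, ha z w] at k3
  -- Up to sign the expression is symmetric in `y, z, w`, so `h x y`, `h x z` and `h x w` all
  -- annihilate it; if all three vanish, so does each of its terms.
  by_contra hne
  rcases mul_eq_zero.1 k1 with h1 | h1
  · rcases mul_eq_zero.1 k2 with h2 | h2
    · rcases mul_eq_zero.1 k3 with h3 | h3
      · exact hne (by rw [h1, h2, h3]; ring)
      · exact hne (by linear_combination h3)
    · exact hne (by linear_combination -h2)
  · exact hne h1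

theorem ellE_zero_right (x : ℂ) : ellE x 0 = 1 - x := by
  rw [ellE, tprod_one_sub_eq (by simp)]
  simp

theorem symTheta_zero (z : ℂ) :
    symTheta 0 z = Complex.exp (-z / 2) - Complex.exp (z / 2) := by
  rw [symTheta, ellE_zero_right, mul_sub, mul_one, ← Complex.exp_add]
  ring_nf

theorem isThetaLike_symTheta_zero : IsThetaLike (symTheta 0) where
  neg := symTheta_neg (by simp)
  three_term := by
    -- The product is `φ x - φ y` with `φ x = e^x + e^(-x)`, which makes the relation a polynomial
    -- identity. The case `p = 0` is separate because `0` is not an exponential.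
    have h : ∀ x y : ℂ, symTheta 0 (x + y) * symTheta 0 (x - y) =
        Complex.exp x + Complex.exp (-x) - Complex.exp y - Complex.exp (-y) := by
      intro x y
      rw [symTheta_zero, symTheta_zero, sub_mul, mul_sub, mul_sub, ← Complex.exp_add,
        ← Complex.exp_add, ← Complex.exp_add, ← Complex.exp_add]
      ring_nf
    intro x y z w
    simp only [h]
    ring

theorem exists_exp_eq {p : ℂ} (hp : ‖p‖ < 1) (hp0 : p ≠ 0) :
    ∃ τ : ℂ, 0 < τ.im ∧ Complex.exp (2 * Real.pi * Complex.I * τ) = p := by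
  refine ⟨Complex.log p / (2 * Real.pi * Complex.I), ?_, ?_⟩
  · have e : Complex.log p / (2 * Real.pi * Complex.I) =
        ((1 / (2 * Real.pi) : ℝ) : ℂ) * (-(Complex.I * Complex.log p)) := by
      have := Complex.I_sq
      have h2 : (Real.pi : ℂ) ≠ 0 := by exact_mod_cast Real.pi_ne_zero
      push_cast
      field_simp
      linear_combination Complex.log p * this
    rw [e, Complex.im_ofReal_mul]
    refine mul_pos (by positivity) ?_
    have h3 : (-(Complex.I * Complex.log p)).im = -Real.log ‖p‖ := by simp [Complex.log_re]
    rw [h3]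
    exact neg_pos.2 (Real.log_neg (norm_pos_iff.2 hp0) hp)
  · rw [mul_div_cancel₀ _ Complex.two_pi_I_ne_zero, Complex.exp_log hp0]

/-- The coefficients `(-1)^k p^{k (k - 1) / 2}` of the bilateral theta series, `p = e^{2πiτ}`. -/
noncomputable def thetaCoeff (τ : ℂ) (k : ℤ) : ℂ :=
  Complex.exp (Real.pi * Complex.I * k + Real.pi * Complex.I * τ * (k ^ 2 - k))

theorem thetaCoeff_succ {τ p : ℂ} (hτ : Complex.exp (2 * Real.pi * Complex.I * τ) = p) (k : ℤ) :
    thetaCoeff τ (k + 1) = -(p ^ k) * thetaCoeff τ k := by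
  rw [thetaCoeff, thetaCoeff, ← hτ, ← Complex.exp_int_mul, ← neg_one_mul, ← Complex.exp_pi_mul_I,
    ← Complex.exp_add, ← Complex.exp_add]
  congr 1
  push_cast
  ring

/-- Gives access to the summability and differentiability of `jacobiTheta₂`. -/
theorem thetaCoeff_mul_exp (τ u : ℂ) (k : ℤ) : thetaCoeff τ k * Complex.exp (k * u) =
    jacobiTheta₂_term k (u / (2 * Real.pi * Complex.I) - τ / 2 + 1 / 2) τ := by
  have h2 : (Real.pi : ℂ) ≠ 0 := by exact_mod_cast Real.pi_ne_zero
  have h3 := Complex.I_ne_zero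
  rw [thetaCoeff, jacobiTheta₂_term, ← Complex.exp_add]
  congr 1
  field_simp
  ring

theorem ellE_exp_eq_tsum {p τ D : ℂ} (hp : ‖p‖ < 1) (hp0 : p ≠ 0) (hτ0 : 0 < τ.im)
    (hτ : Complex.exp (2 * Real.pi * Complex.I * τ) = p) (hD : D ≠ 0)
    (hlim : Tendsto (eulerProd p) atTop (𝓝 D)) (u : ℂ) :
    (Summable fun k : ℤ => thetaCoeff τ k * Complex.exp (k * u)) ∧
    ellE (Complex.exp u) p = D⁻¹ * ∑' k : ℤ, thetaCoeff τ k * Complex.exp (k * u) := by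
  have hs : Summable fun k : ℤ => thetaCoeff τ k * Complex.exp (k * u) := by
    simp only [thetaCoeff_mul_exp]
    exact (summable_jacobiTheta₂_term_iff _ _).2 hτ0
  refine ⟨hs, ellE_mul_eq_tsum hp hp0 (Complex.exp_ne_zero u) hD hlim _ ?_ (fun k => ?_) hs⟩
  · simp [thetaCoeff]
  · rw [thetaCoeff_succ hτ]
    push_cast
    rw [add_mul, one_mul, Complex.exp_add]
    ring

theorem continuous_symTheta {p : ℂ} (hp : ‖p‖ < 1) : Continuous (symTheta p) := by
  by_cases hp0 : p = 0
  · subst hp0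
    rw [funext symTheta_zero]
    fun_prop
  · obtain ⟨τ, hτ0, hτ⟩ := exists_exp_eq hp hp0
    obtain ⟨D, hD, hlim⟩ := exists_eulerProd_tendsto hp
    have e : symTheta p = fun u => Complex.exp (-u / 2) *
        (D⁻¹ * jacobiTheta₂ (u / (2 * Real.pi * Complex.I) - τ / 2 + 1 / 2) τ) := by
      funext u
      rw [symTheta, (ellE_exp_eq_tsum hp hp0 hτ0 hτ hD hlim u).2, jacobiTheta₂]
      simp only [thetaCoeff_mul_exp]
    have hc : Continuous fun z => jacobiTheta₂ z τ :=
      continuous_iff_continuousAt.2 fun z => (differentiableAt_jacobiTheta₂_fst z hτ0).continuousAt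
    rw [e]
    have := hc.comp (f := fun u : ℂ => u / (2 * Real.pi * Complex.I) - τ / 2 + 1 / 2) (by fun_prop)
    exact (by fun_prop : Continuous fun u : ℂ => Complex.exp (-u / 2)).mul
      (continuous_const.mul this)

/-- The sums `∑ k, c k c (n - k) e^{(2k - n) y}`, for which the shift `n ↦ n + 2` is a scaling. -/
noncomputable def thetaConv (τ : ℂ) (n : ℤ) (y : ℂ) : ℂ :=
  ∑' k : ℤ, thetaCoeff τ k * thetaCoeff τ (n - k) * Complex.exp ((2 * k - n) * y)

/-- Under `k ↦ k + 1` the exponent `2k - n` is unchanged, while the two coefficients gain `-p^k` and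
`-p^(n-k)`, whose product does not depend on `k`. -/
theorem thetaConv_add_two {τ p : ℂ} (hτ : Complex.exp (2 * Real.pi * Complex.I * τ) = p)
    (n : ℤ) (y : ℂ) : thetaConv τ (n + 2) y = p ^ n * thetaConv τ n y := by
  have hp0 : p ≠ 0 := hτ ▸ Complex.exp_ne_zero _
  rw [thetaConv, thetaConv, ← tsum_mul_left, ← (Equiv.addRight (1 : ℤ)).tsum_eq]
  refine tsum_congr fun k => ?_
  have e1 : n + 2 - (k + 1) = n - k + 1 := by ring
  have e2 : p ^ n = p ^ k * p ^ (n - k) := by rw [← zpow_add₀ hp0]; ring_nf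
  have e3 : (2 * ((k + 1 : ℤ) : ℂ) - (n + 2 : ℤ)) = 2 * k - n := by push_cast; ring
  simp only [Equiv.coe_addRight]
  rw [e1, e2, e3, thetaCoeff_succ hτ, thetaCoeff_succ hτ]
  ring

theorem exists_thetaConv_eq {τ p : ℂ} (hτ : Complex.exp (2 * Real.pi * Complex.I * τ) = p) (r : ℤ)
    (m : ℤ) : ∃ u : ℂ, ∀ y, thetaConv τ (2 * m + r) y = u * thetaConv τ r y := by
  have hp0 : p ≠ 0 := hτ ▸ Complex.exp_ne_zero _
  induction m using Int.induction_on with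
  | zero => exact ⟨1, fun y => by simp⟩
  | succ i ih =>
    obtain ⟨u, hu⟩ := ih
    refine ⟨p ^ (2 * (i : ℤ) + r) * u, fun y => ?_⟩
    rw [show 2 * ((i : ℤ) + 1) + r = 2 * i + r + 2 by ring, thetaConv_add_two hτ, hu, mul_assoc]
  | pred i ih =>
    obtain ⟨u, hu⟩ := ih
    refine ⟨(p ^ (2 * (-(i : ℤ) - 1) + r))⁻¹ * u, fun y => ?_⟩
    rw [mul_assoc, ← hu, show 2 * (-(i : ℤ)) + r = 2 * (-(i : ℤ) - 1) + r + 2 by ring,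
      thetaConv_add_two hτ, inv_mul_cancel_left₀ (zpow_ne_zero _ hp0)]

/-- Only the parity of `n` matters, which is the source of rank two. The clause `u n = 0 ∨ v n = 0`
serves convergence: it makes each half of the split series termwise dominated by the whole. -/
theorem exists_thetaConv_decomp {τ p : ℂ} (hτ : Complex.exp (2 * Real.pi * Complex.I * τ) = p) :
    ∃ u v : ℤ → ℂ, ∀ n y,
      thetaConv τ n y = u n * thetaConv τ 0 y + v n * thetaConv τ 1 y ∧
      (u n = 0 ∨ v n = 0) := by
  have h : ∀ n : ℤ, ∃ uv : ℂ × ℂ, ∀ y,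
      thetaConv τ n y = uv.1 * thetaConv τ 0 y + uv.2 * thetaConv τ 1 y ∧
      (uv.1 = 0 ∨ uv.2 = 0) := by
    intro n
    rcases Int.even_or_odd' n with ⟨m, rfl | rfl⟩
    · obtain ⟨u, hu⟩ := exists_thetaConv_eq hτ 0 m
      rw [add_zero] at hu
      exact ⟨(u, 0), fun y => by simp [hu]⟩
    · obtain ⟨u, hu⟩ := exists_thetaConv_eq hτ 1 m
      exact ⟨(0, u), fun y => by simp [hu]⟩
  choose uv huv using h
  exact ⟨fun n => (uv n).1, fun n => (uv n).2, huv⟩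

/-- The product of the theta series at `x + y` and `x - y`, collected by total degree `n`, is `∑
e^(nx) thetaConv τ n y`; every `thetaConv τ n` is a multiple of one of two functions of `y`. -/
theorem isThetaLike_symTheta {p : ℂ} (hp : ‖p‖ < 1) : IsThetaLike (symTheta p) := by
  by_cases hp0 : p = 0
  · subst hp0
    exact isThetaLike_symTheta_zero
  obtain ⟨τ, hτ0, hτ⟩ := exists_exp_eq hp hp0
  obtain ⟨D, hD, hlim⟩ := exists_eulerProd_tendsto hp
  obtain ⟨u, v, huv⟩ := exists_thetaConv_decomp hτ
  have hE := ellE_exp_eq_tsum hp hp0 hτ0 hτ hD hlim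
  have key : ∀ x y, symTheta p (x + y) * symTheta p (x - y) =
      (Complex.exp (-x) * D⁻¹ ^ 2 * ∑' n : ℤ, Complex.exp (n * x) * u n) * thetaConv τ 0 y +
      (Complex.exp (-x) * D⁻¹ ^ 2 * ∑' n : ℤ, Complex.exp (n * x) * v n) * thetaConv τ 1 y := by
    intro x y
    -- Indexes pairs by total degree: `(n, k)` goes to `(k, n - k)`.
    set e : ℤ × ℤ ≃ ℤ × ℤ :=
      { toFun := fun q => (q.2, q.1 - q.2)
        invFun := fun q => (q.1 + q.2, q.1)
        left_inv := fun q => by simp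
        right_inv := fun q => by simp } with he
    let F : ℂ → ℤ → ℂ := fun t k => thetaCoeff τ k * Complex.exp (k * t)
    have hF : ∀ t, Summable fun k => ‖F t k‖ := fun t => (hE t).1.norm
    let G : ℤ × ℤ → ℂ := fun q => F (x + y) q.1 * F (x - y) q.2
    have hGs : Summable G := summable_mul_of_summable_norm (hF (x + y)) (hF (x - y))
    have hGe : ∀ q : ℤ × ℤ, G (e q) = Complex.exp (q.1 * x) *
        (thetaCoeff τ q.2 * thetaCoeff τ (q.1 - q.2) * Complex.exp ((2 * q.2 - q.1) * y)) := by
      intro q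
      have : Complex.exp (q.2 * (x + y)) * Complex.exp ((q.1 - q.2 : ℤ) * (x - y)) =
          Complex.exp (q.1 * x) * Complex.exp ((2 * q.2 - q.1) * y) := by
        rw [← Complex.exp_add, ← Complex.exp_add]
        congr 1
        push_cast
        ring
      change thetaCoeff τ q.2 * Complex.exp (q.2 * (x + y)) *
        (thetaCoeff τ (q.1 - q.2) * Complex.exp ((q.1 - q.2 : ℤ) * (x - y))) = _
      rw [mul_mul_mul_comm, this, mul_left_comm]
    have hGes : Summable fun q => G (e q) := e.summable_iff.2 hGs
    have hsum : (∑' k : ℤ, thetaCoeff τ k * Complex.exp (k * (x + y))) *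
        (∑' k : ℤ, thetaCoeff τ k * Complex.exp (k * (x - y))) =
        ∑' n : ℤ, Complex.exp (n * x) * thetaConv τ n y := by
      refine (tsum_mul_tsum_of_summable_norm (hF (x + y)) (hF (x - y))).trans ?_
      change ∑' q, G q = _
      rw [← e.tsum_eq, hGes.tsum_prod]
      refine tsum_congr fun n => ?_
      rw [thetaConv, ← tsum_mul_left]
      exact tsum_congr fun k => hGe (n, k)
    have hs : Summable fun n : ℤ => Complex.exp (n * x) * thetaConv τ n y := by
      refine hGes.prod.congr fun n => ?_
      rw [thetaConv, ← tsum_mul_left]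
      exact tsum_congr fun k => (hGe (n, k))
    have hsu : Summable fun n : ℤ => Complex.exp (n * x) * u n * thetaConv τ 0 y := by
      refine Summable.of_norm_bounded hs.norm fun n => ?_
      rcases (huv n y).2 with h | h
      · simp [h]
      · rw [(huv n y).1, h, zero_mul, add_zero, mul_assoc]
    have hsv : Summable fun n : ℤ => Complex.exp (n * x) * v n * thetaConv τ 1 y := by
      refine Summable.of_norm_bounded hs.norm fun n => ?_
      rcases (huv n y).2 with h | h
      · rw [(huv n y).1, h, zero_mul, zero_add, mul_assoc]
      · simp [h]
    have hsplit : ∑' n : ℤ, Complex.exp (n * x) * thetaConv τ n y =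
        (∑' n : ℤ, Complex.exp (n * x) * u n) * thetaConv τ 0 y +
        (∑' n : ℤ, Complex.exp (n * x) * v n) * thetaConv τ 1 y := by
      rw [← tsum_mul_right, ← tsum_mul_right, ← hsu.tsum_add hsv]
      refine tsum_congr fun n => ?_
      rw [(huv n y).1]
      ring
    have hexp : Complex.exp (-x) =
        Complex.exp (-(x + y) / 2) * Complex.exp (-(x - y) / 2) := by
      rw [← Complex.exp_add]; ring_nf
    rw [symTheta, symTheta, (hE _).2, (hE _).2, hexp]
    linear_combination Complex.exp (-(x + y) / 2) * Complex.exp (-(x - y) / 2) * D⁻¹ ^ 2 *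
      (hsum + hsplit)
  refine ⟨symTheta_neg hp, fun x y z w => ?_⟩
  have h0 : symTheta p 0 = 0 := by rw [symTheta, Complex.exp_zero, ellE_one, mul_zero]
  refine plucker_of_rank_two (h := fun x y => symTheta p (x + y) * symTheta p (x - y)) key
    (fun x y => ?_) (fun x => ?_) x y z w
  · rw [← neg_sub x y, symTheta_neg hp, add_comm, mul_neg]
  · rw [sub_self, h0, mul_zero]

/-- A convergent product vanishes only if some factor does, so `e^z` lies in a countable set, and
the fibres of `exp` are countable. This is what makes generic parameters dense. -/
theorem countable_symTheta_zeros {p : ℂ} (hp : ‖p‖ < 1) : {z | symTheta p z = 0}.Countable := by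
  have hc : ∀ c : ℂ, {z | Complex.exp z = c}.Countable := by
    intro c
    by_cases h : ∃ z₀, Complex.exp z₀ = c
    · obtain ⟨z₀, rfl⟩ := h
      refine (Set.countable_range fun n : ℤ => z₀ + n * (2 * Real.pi * Complex.I)).mono ?_
      intro z hz
      obtain ⟨n, hn⟩ := Complex.exp_eq_exp_iff_exists_int.1 hz
      exact ⟨n, hn.symm⟩
    · refine Set.countable_empty.mono fun z hz => (h ⟨z, hz⟩).elim
  have hz : ∀ x : ℂ, (∀ k : ℕ, 1 - x * p ^ k ≠ 0) → ∏' k : ℕ, (1 - x * p ^ k) ≠ 0 := by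
    intro x hx
    have hs : Summable fun k : ℕ => ‖-(x * p ^ k)‖ := by
      simp only [norm_neg, norm_mul, norm_pow]
      exact (summable_geometric_of_lt_one (norm_nonneg p) hp).mul_left _
    have := tprod_one_add_ne_zero_of_summable (f := fun k : ℕ => -(x * p ^ k))
      (fun k => by rw [← sub_eq_add_neg]; exact hx k) hs
    simpa only [← sub_eq_add_neg] using this
  refine ((Set.countable_iUnion fun k : ℕ => hc (p ^ k)⁻¹).union
    (Set.countable_iUnion fun k : ℕ => hc (p * p ^ k))).mono fun z hz0 => ?_
  by_contra hne
  simp only [Set.mem_union, Set.mem_iUnion, Set.mem_ofPred_eq, not_or, not_exists] at hne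
  have hz1 : symTheta p z = 0 := hz0
  rw [symTheta, ellE, mul_eq_zero, mul_eq_zero] at hz1
  rcases hz1 with h | h | h
  · exact Complex.exp_ne_zero _ h
  · exact hz _ (fun k hk => hne.1 k (eq_inv_of_mul_eq_one_left (sub_eq_zero.1 hk).symm)) h
  · refine hz _ (fun k hk => hne.2 k ?_) h
    have := Complex.exp_ne_zero z
    field_simp at hk
    linear_combination hk

/-! ### Products of a theta-like function along arithmetic progressions -/

/-- The product `∏_{i < k} s (x + i h)`. -/
noncomputable def shiftProd (s : ℂ → ℂ) (x h : ℂ) (k : ℕ) : ℂ :=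
  ∏ i ∈ Finset.range k, s (x + i * h)

theorem shiftProd_zero (s : ℂ → ℂ) (x h : ℂ) : shiftProd s x h 0 = 1 := rfl

theorem shiftProd_one (s : ℂ → ℂ) (x h : ℂ) : shiftProd s x h 1 = s x := by
  simp [shiftProd]

theorem shiftProd_succ (s : ℂ → ℂ) (x h : ℂ) (k : ℕ) :
    shiftProd s x h (k + 1) = shiftProd s x h k * s (x + k * h) := Finset.prod_range_succ _ _

theorem shiftProd_add (s : ℂ → ℂ) (x h : ℂ) (m k : ℕ) :
    shiftProd s x h (m + k) = shiftProd s x h m * shiftProd s (x + m * h) h k := by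
  rw [shiftProd, Finset.prod_range_add]
  refine congrArg₂ _ rfl (Finset.prod_congr rfl fun i _ => ?_)
  congr 1
  push_cast
  ring

theorem shiftProd_succ' (s : ℂ → ℂ) (x h : ℂ) (k : ℕ) :
    shiftProd s x h (k + 1) = s x * shiftProd s (x + h) h k := by
  rw [add_comm, shiftProd_add, shiftProd_one]
  simp

theorem shiftProd_shift (s : ℂ → ℂ) (x h : ℂ) (k : ℕ) :
    shiftProd s x h k * s (x + k * h) = s x * shiftProd s (x + h) h k := by
  rw [← shiftProd_succ, shiftProd_succ']

theorem shiftProd_shift_two (s : ℂ → ℂ) (x h : ℂ) (k : ℕ) :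
    shiftProd s x h k * (s (x + k * h) * s (x + (k + 1) * h)) =
      s x * s (x + h) * shiftProd s (x + 2 * h) h k := by
  have h1 := shiftProd_shift s x h k
  have h2 := shiftProd_shift s (x + h) h k
  rw [show x + h + k * h = x + (k + 1) * h by ring, show x + h + h = x + 2 * h by ring] at h2
  linear_combination s (x + (k + 1) * h) * h1 + s x * h2

theorem shiftProd_ne_zero {s : ℂ → ℂ} {x h : ℂ} {k : ℕ} (hs : ∀ i < k, s (x + i * h) ≠ 0) :
    shiftProd s x h k ≠ 0 :=
  Finset.prod_ne_zero_iff.2 fun i hi => hs i (Finset.mem_range.1 hi)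

theorem shiftProd_reflect {s : ℂ → ℂ} (hs : IsThetaLike s) (x h : ℂ) (k : ℕ) :
    shiftProd s x h k = (-1) ^ k * shiftProd s (-(x + (k - 1) * h)) h k := by
  rw [shiftProd, ← Finset.prod_range_reflect, shiftProd]
  nth_rewrite 3 [← Finset.card_range k]
  rw [← Finset.prod_const, ← Finset.prod_mul_distrib]
  refine Finset.prod_congr rfl fun i hi => ?_
  rw [Finset.mem_range] at hi
  rw [neg_one_mul, ← hs.neg]
  congr 1
  rw [Nat.sub_sub, Nat.cast_sub (by omega)]
  push_cast
  ring

theorem IsThetaLike.zero {s : ℂ → ℂ} (hs : IsThetaLike s) : s 0 = 0 := by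
  have := hs.neg 0
  rw [neg_zero] at this
  linear_combination this / 2

/-- The three-term relation, as an interpolation formula for `u ↦ s (b + u) s (c + u)`. -/
theorem IsThetaLike.interpolate {s : ℂ → ℂ} (hs : IsThetaLike s) (b c u v w : ℂ) :
    s (b + u) * s (c + u) * (s (b + c + v + w) * s (v - w)) =
      s (b + c + u + w) * s (u - w) * (s (b + v) * s (c + v)) +
      s (b + c + u + v) * s (v - u) * (s (b + w) * s (c + w)) := by
  -- Half-sum and half-difference are chosen so that the first pair of arguments is `b + u` and `c +
  -- u`.
  have e := hs.three_term ((b + c) / 2 + u) ((b - c) / 2) ((b + c) / 2 + v) ((b + c) / 2 + w)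
  rw [show (b + c) / 2 + u + (b - c) / 2 = b + u by ring,
    show (b + c) / 2 + u - (b - c) / 2 = c + u by ring,
    show (b + c) / 2 + v + ((b + c) / 2 + w) = b + c + v + w by ring,
    show (b + c) / 2 + v - ((b + c) / 2 + w) = v - w by ring,
    show (b + c) / 2 + u + ((b + c) / 2 + v) = b + c + u + v by ring,
    show (b + c) / 2 + u - ((b + c) / 2 + v) = u - v by ring,
    show (b - c) / 2 + ((b + c) / 2 + w) = b + w by ring,
    show (b - c) / 2 - ((b + c) / 2 + w) = -(c + w) by ring,
    show (b + c) / 2 + u + ((b + c) / 2 + w) = b + c + u + w by ring,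
    show (b + c) / 2 + u - ((b + c) / 2 + w) = u - w by ring,
    show (b - c) / 2 + ((b + c) / 2 + v) = b + v by ring,
    show (b - c) / 2 - ((b + c) / 2 + v) = -(c + v) by ring, hs.neg, hs.neg] at e
  rw [show v - u = -(u - v) by ring, hs.neg]
  linear_combination e

/-! ### The cubic binomial theorem and the summable case -/

/-- The coefficients of the cubic summation formula. -/
noncomputable def cubicCoeff (s : ℂ → ℂ) (h a : ℂ) (n k : ℕ) : ℂ :=
  s (a + 4 * k * h) / s a * shiftProd s a h k * shiftProd s (-(n * h)) h (2 * k) *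
    shiftProd s ((n + 1) * h) h k /
    (shiftProd s (a + (n + 1) * h) h (2 * k) * shiftProd s (3 * h) (3 * h) k *
      shiftProd s (a + (2 - n) * h) (3 * h) k) *
    (shiftProd s (a + (2 - n) * h) (3 * h) n / shiftProd s (a + h) h n)

section Cubic

variable {s : ℂ → ℂ} (hs : IsThetaLike s) {h : ℂ} (hh : ∀ m : ℤ, m ≠ 0 → s (m * h) ≠ 0)
include hs hh

omit hs hh in
theorem shiftProd_lattice_ne_zero {x : ℂ} (hx : ∀ m : ℤ, s (x + m * h) ≠ 0) {y g : ℂ} {m j : ℤ}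
    (hy : y = x + m * h) (hg : g = j * h) (k : ℕ) : shiftProd s y g k ≠ 0 := by
  refine shiftProd_ne_zero fun i _ => ?_
  have := hx (m + i * j)
  rw [hy, hg]
  convert this using 2
  push_cast
  ring

omit hs in
theorem shiftProd_multiples_ne_zero (k : ℕ) : shiftProd s (3 * h) (3 * h) k ≠ 0 := by
  refine shiftProd_ne_zero fun i _ => ?_
  have := hh (3 * (i + 1)) (by omega)
  convert this using 2
  push_cast
  ring

theorem cubicCoeff_succ {a : ℂ} (ha : ∀ m : ℤ, s (a + m * h) ≠ 0) (n k : ℕ) :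
    cubicCoeff s h a n (k + 1) = cubicCoeff s h a n k *
      (s (a + (4 * k + 4) * h) * s (a + k * h) * (s ((n - 2 * k) * h) * s ((n - 2 * k - 1) * h)) *
          s ((n + 1 + k) * h) /
        (s (a + 4 * k * h) * s (a + (n + 1 + 2 * k) * h) * s (a + (n + 2 + 2 * k) * h) *
          s ((3 * k + 3) * h) * s (a + (2 - n + 3 * k) * h))) := by
  have h1 : s (a + 4 * k * h) ≠ 0 := by simpa using ha (4 * k)
  have h2 : s (a + (n + 1 + 2 * k) * h) ≠ 0 := by simpa using ha (n + 1 + 2 * k)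
  have h3 : s (a + (n + 2 + 2 * k) * h) ≠ 0 := by simpa using ha (n + 2 + 2 * k)
  have h4 : s ((3 * k + 3) * h) ≠ 0 := by simpa using hh (3 * k + 3) (by omega)
  have h5 : s (a + (2 - n + 3 * k) * h) ≠ 0 := by simpa using ha (2 - n + 3 * k)
  have h6 : s a ≠ 0 := by simpa using ha 0
  have h7 : shiftProd s (a + (n + 1) * h) h (2 * k) ≠ 0 :=
    shiftProd_lattice_ne_zero ha (m := n + 1) (j := 1) (by simp) (by simp) _
  have h8 := shiftProd_multiples_ne_zero hh k
  have h9 : shiftProd s (a + (2 - n) * h) (3 * h) k ≠ 0 :=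
    shiftProd_lattice_ne_zero ha (m := 2 - n) (j := 3) (by simp) (by simp) _
  have e1 : s (-(n * h) + (2 * k : ℕ) * h) = -s ((n - 2 * k) * h) := by
    rw [← hs.neg]; congr 1; push_cast; ring
  have e2 : s (-(n * h) + (2 * k + 1 : ℕ) * h) = -s ((n - 2 * k - 1) * h) := by
    rw [← hs.neg]; congr 1; push_cast; ring
  rw [cubicCoeff, cubicCoeff, show 2 * (k + 1) = 2 * k + 1 + 1 by ring]
  simp only [shiftProd_succ, e1, e2]
  rw [show a + 4 * ((k + 1 : ℕ) : ℂ) * h = a + (4 * k + 4) * h by push_cast; ring,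
    show (n + 1) * h + k * h = (n + 1 + k) * h by ring,
    show a + (n + 1) * h + (2 * k : ℕ) * h = a + (n + 1 + 2 * k) * h by push_cast; ring,
    show a + (n + 1) * h + (2 * k + 1 : ℕ) * h = a + (n + 2 + 2 * k) * h by push_cast; ring,
    show 3 * h + k * (3 * h) = (3 * k + 3) * h by ring,
    show a + (2 - n) * h + k * (3 * h) = a + (2 - n + 3 * k) * h by ring]
  generalize shiftProd s (a + (n + 1) * h) h (2 * k) = A1 at *
  generalize shiftProd s (3 * h) (3 * h) k = A2 at *
  generalize shiftProd s (a + (2 - n) * h) (3 * h) k = A3 at *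
  generalize shiftProd s (a + (2 - n) * h) (3 * h) n / shiftProd s (a + h) h n = A4
  generalize s (a + 4 * k * h) = B1 at *
  generalize s (a + (n + 1 + 2 * k) * h) = B2 at *
  generalize s (a + (n + 2 + 2 * k) * h) = B3 at *
  generalize s ((3 * k + 3) * h) = B4 at *
  generalize s (a + (2 - n + 3 * k) * h) = B5 at *
  generalize s a = B6 at *
  clear e1 e2 ha hh hs
  field_simp

/-- In `cubic_binomial` the point `σ = a + N h` is fixed, so raising `N` by one sends `a` to `a - h`
and `n` to `n + 2`. The bound on `k` keeps the two denominators with `n + 2 - 2k` and `n + 1 - 2k`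
off the zero `s 0`. -/
theorem cubicCoeff_shift {a : ℂ} (ha : ∀ m : ℤ, s (a + m * h) ≠ 0) {n k : ℕ} (hk : 2 * k ≤ n) :
    cubicCoeff s h (a - h) (n + 2) k = cubicCoeff s h a n k *
      (s (a + (4 * k - 1) * h) * (s ((n + 1 + k) * h) * s ((n + 2 + k) * h)) *
          s (a + (3 * k - n - 1) * h) * s (a + (2 * n + 2) * h) /
        (s (a + 4 * k * h) * s (a + (k - 1) * h) *
          (s ((n + 2 - 2 * k) * h) * s ((n + 1 - 2 * k) * h)) *
          s (a + (n + 1 + 2 * k) * h))) := by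
  have n1 : s (a + 4 * k * h) ≠ 0 := by simpa using ha (4 * k)
  have n2 : s (a + (k - 1) * h) ≠ 0 := by simpa using ha (k - 1)
  have n3 : s ((n + 2 - 2 * k) * h) ≠ 0 := by simpa using hh (n + 2 - 2 * k) (by omega)
  have n4 : s ((n + 1 - 2 * k) * h) ≠ 0 := by simpa using hh (n + 1 - 2 * k) (by omega)
  have n5 : s (a + (n + 1 + 2 * k) * h) ≠ 0 := by simpa using ha (n + 1 + 2 * k)
  have n6 : s a ≠ 0 := by simpa using ha 0
  have n7 : s (a - h) ≠ 0 := by simpa [sub_eq_add_neg] using ha (-1)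
  have n8 : s ((n + 1) * h) ≠ 0 := by simpa using hh (n + 1) (by omega)
  have n9 : s ((n + 2) * h) ≠ 0 := by simpa using hh (n + 2) (by omega)
  have n10 : s (a + (n + 1) * h) ≠ 0 := by simpa using ha (n + 1)
  have n11 : s (a + (3 * k - n - 1) * h) ≠ 0 := by simpa using ha (3 * k - n - 1)
  have n12 : s (a + (-n - 1) * h) ≠ 0 := by simpa using ha (-n - 1)
  have n13 : shiftProd s (a + (n + 1) * h) h (2 * k) ≠ 0 :=
    shiftProd_lattice_ne_zero ha (m := n + 1) (j := 1) (by simp) (by simp) _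
  have n14 := shiftProd_multiples_ne_zero hh k
  have n15 : shiftProd s (a + (2 - n) * h) (3 * h) k ≠ 0 :=
    shiftProd_lattice_ne_zero ha (m := 2 - n) (j := 3) (by simp) (by simp) _
  have n16 : shiftProd s (a + h) h n ≠ 0 :=
    shiftProd_lattice_ne_zero ha (m := 1) (j := 1) (by simp) (by simp) _
  have r1 : shiftProd s (a - h) h k = s (a - h) * shiftProd s a h k / s (a + (k - 1) * h) := by
    rw [eq_div_iff n2]
    have := shiftProd_shift s (a - h) h k
    rwa [show a - h + k * h = a + (k - 1) * h by ring, sub_add_cancel] at this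
  have r2 : shiftProd s (-((n + 2 : ℕ) * h)) h (2 * k) = s ((n + 2) * h) * s ((n + 1) * h) *
      shiftProd s (-(n * h)) h (2 * k) /
      (s ((n + 2 - 2 * k) * h) * s ((n + 1 - 2 * k) * h)) := by
    rw [eq_div_iff (mul_ne_zero n3 n4)]
    have := shiftProd_shift_two s (-((n + 2 : ℕ) * h)) h (2 * k)
    rw [show -((n + 2 : ℕ) * h) + (2 * k : ℕ) * h = -((n + 2 - 2 * k) * h) by push_cast; ring,
      show -((n + 2 : ℕ) * h) + ((2 * k : ℕ) + 1) * h = -((n + 1 - 2 * k) * h) by push_cast; ring,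
      show -((n + 2 : ℕ) * h) + h = -((n + 1) * h) by push_cast; ring,
      show -((n + 2 : ℕ) * h) + 2 * h = -(n * h) by push_cast; ring, hs.neg, hs.neg, hs.neg,
      hs.neg, show ((n + 2 : ℕ) : ℂ) = n + 2 by push_cast; ring] at this
    rw [show ((n + 2 : ℕ) : ℂ) = n + 2 by push_cast; ring]
    linear_combination this
  have r3 : shiftProd s (((n + 2 : ℕ) + 1) * h) h k =
      shiftProd s ((n + 1) * h) h k * (s ((n + 1 + k) * h) * s ((n + 2 + k) * h)) /
        (s ((n + 1) * h) * s ((n + 2) * h)) := by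
    rw [eq_div_iff (mul_ne_zero n8 n9)]
    have := shiftProd_shift_two s ((n + 1) * h) h k
    rw [show (n + 1) * h + k * h = (n + 1 + k) * h by ring,
      show (n + 1) * h + (k + 1) * h = (n + 2 + k) * h by ring,
      show (n + 1) * h + h = (n + 2) * h by ring,
      show (n + 1) * h + 2 * h = ((n + 2 : ℕ) + 1) * h by push_cast; ring] at this
    linear_combination -this
  have r4 : shiftProd s (a - h + ((n + 2 : ℕ) + 1) * h) h (2 * k) =
      shiftProd s (a + (n + 1) * h) h (2 * k) * s (a + (n + 1 + 2 * k) * h) /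
        s (a + (n + 1) * h) := by
    rw [eq_div_iff n10]
    have := shiftProd_shift s (a + (n + 1) * h) h (2 * k)
    rw [show a + (n + 1) * h + (2 * k : ℕ) * h = a + (n + 1 + 2 * k) * h by push_cast; ring,
      show a + (n + 1) * h + h = a - h + ((n + 2 : ℕ) + 1) * h by push_cast; ring] at this
    linear_combination -this
  have e5 : a - h + (2 - (n + 2 : ℕ)) * h = a + (-n - 1) * h := by push_cast; ring
  have e6 : a + (-n - 1) * h + 3 * h = a + (2 - n) * h := by ring
  have r5 : shiftProd s (a - h + (2 - (n + 2 : ℕ)) * h) (3 * h) k =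
      s (a + (-n - 1) * h) * shiftProd s (a + (2 - n) * h) (3 * h) k /
        s (a + (3 * k - n - 1) * h) := by
    rw [eq_div_iff n11, e5]
    have := shiftProd_shift s (a + (-n - 1) * h) (3 * h) k
    rwa [show a + (-n - 1) * h + k * (3 * h) = a + (3 * k - n - 1) * h by ring, e6] at this
  have r6 : shiftProd s (a - h + (2 - (n + 2 : ℕ)) * h) (3 * h) (n + 2) =
      s (a + (-n - 1) * h) * (shiftProd s (a + (2 - n) * h) (3 * h) n *
        s (a + (2 * n + 2) * h)) := by
    rw [e5, shiftProd_succ', e6, shiftProd_succ,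
      show a + (2 - n) * h + n * (3 * h) = a + (2 * n + 2) * h by ring]
  have r7 : shiftProd s (a - h + h) h (n + 2) =
      s a * (shiftProd s (a + h) h n * s (a + (n + 1) * h)) := by
    rw [sub_add_cancel, shiftProd_succ', shiftProd_succ,
      show a + h + n * h = a + (n + 1) * h by ring]
  rw [cubicCoeff, cubicCoeff, r1, r2, r3, r4, r5, r6, r7,
    show a - h + 4 * k * h = a + (4 * k - 1) * h by ring]
  clear r1 r2 r3 r4 r5 r6 r7 e5 e6 ha hh hs
  generalize shiftProd s (a + (n + 1) * h) h (2 * k) = A1 at *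
  generalize shiftProd s (3 * h) (3 * h) k = A2 at *
  generalize shiftProd s (a + (2 - n) * h) (3 * h) k = A3 at *
  generalize shiftProd s (a + h) h n = A4 at *
  generalize s (a + 4 * k * h) = B1 at *
  generalize s (a + (k - 1) * h) = B2 at *
  generalize s ((n + 2 - 2 * k) * h) = B3 at *
  generalize s ((n + 1 - 2 * k) * h) = B4 at *
  generalize s (a + (n + 1 + 2 * k) * h) = B5 at *
  generalize s a = B6 at *
  generalize s (a - h) = B7 at *
  generalize s ((n + 1) * h) = B8 at *
  generalize s ((n + 2) * h) = B9 at *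
  generalize s (a + (n + 1) * h) = B10 at *
  generalize s (a + (3 * k - n - 1) * h) = B11 at *
  generalize s (a + (-n - 1) * h) = B12 at *
  field_simp

end Cubic

section Cubic

variable {s : ℂ → ℂ} (hs : IsThetaLike s) {h : ℂ} (hh : ∀ m : ℤ, m ≠ 0 → s (m * h) ≠ 0)
include hs hh

omit hh in
theorem shiftProd_neg_eq_zero {n k : ℕ} (hk : n < k) : shiftProd s (-(n * h)) h k = 0 :=
  Finset.prod_eq_zero (Finset.mem_range.2 hk) (by rw [neg_add_cancel, hs.zero])

omit hh in
theorem cubicCoeff_eq_zero (a : ℂ) {n k : ℕ} (hk : n < 2 * k) : cubicCoeff s h a n k = 0 := by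
  simp [cubicCoeff, shiftProd_neg_eq_zero hs hk]

theorem cubicCoeff_shift_zero {a : ℂ} (ha : ∀ m : ℤ, s (a + m * h) ≠ 0) (n : ℕ) :
    cubicCoeff s h (a - h) (n + 2) 0 = cubicCoeff s h a n 0 *
      (s (a + (2 * n + 2) * h) * s (a + (-n - 1) * h) / (s (a + (n + 1) * h) * s a)) := by
  have n1 : s a ≠ 0 := by simpa using ha 0
  have n2 : s (a + -1 * h) ≠ 0 := by simpa using ha (-1)
  have n3 : s ((n + 2) * h) ≠ 0 := by simpa using hh (n + 2) (by omega)
  have n4 : s ((n + 1) * h) ≠ 0 := by simpa using hh (n + 1) (by omega)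
  have n5 : s (a + (n + 1) * h) ≠ 0 := by simpa using ha (n + 1)
  rw [cubicCoeff_shift hs hh ha (Nat.zero_le n)]
  simp only [Nat.cast_zero, mul_zero, zero_sub, add_zero, sub_zero, zero_mul]
  clear ha hh
  generalize s (a + -1 * h) = B1 at *
  generalize s ((n + 2) * h) = B2 at *
  generalize s ((n + 1) * h) = B3 at *
  generalize s (a + (n + 1) * h) = B4 at *
  generalize s a = B5 at *
  field_simp

/-- The Pascal rule that drives the induction in `cubic_binomial`. -/
theorem cubicCoeff_pascal {a : ℂ} (ha : ∀ m : ℤ, s (a + m * h) ≠ 0) {n k : ℕ} (hk : 2 * k ≤ n) :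
    cubicCoeff s h (a - h) (n + 2) (k + 1) =
      cubicCoeff s h a n k *
        (s ((2 * n + 2 - k) * h) * s ((n + 1 + k) * h) /
          (s (a + (n + 1 + 2 * k) * h) * s (a + 4 * k * h))) +
      cubicCoeff s h a n (k + 1) *
        (s (a + (2 * n + 5 + 3 * k) * h) * s (a + (2 - n + 3 * k) * h) /
          (s (a + (n + 3 + 2 * k) * h) * s (a + (4 * k + 4) * h))) := by
  have ha' : ∀ m : ℤ, s (a - h + m * h) ≠ 0 := fun m => by
    have := ha (m - 1)
    convert this using 2
    push_cast
    ring
  have n1 : s (a + 4 * k * h) ≠ 0 := by simpa using ha (4 * k)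
  have n2 : s (a + (n + 1 + 2 * k) * h) ≠ 0 := by simpa using ha (n + 1 + 2 * k)
  have n3 : s (a + (n + 2 + 2 * k) * h) ≠ 0 := by simpa using ha (n + 2 + 2 * k)
  have n4 : s (a + (n + 3 + 2 * k) * h) ≠ 0 := by simpa using ha (n + 3 + 2 * k)
  have n5 : s (a + (4 * k + 4) * h) ≠ 0 := by simpa using ha (4 * k + 4)
  have n6 : s ((3 * k + 3) * h) ≠ 0 := by simpa using hh (3 * k + 3) (by omega)
  have n7 : s (a + (2 - n + 3 * k) * h) ≠ 0 := by simpa using ha (2 - n + 3 * k)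
  have n8 : s (a + (4 * k - 1) * h) ≠ 0 := by simpa using ha (4 * k - 1)
  have n9 : s (a + (k - 1) * h) ≠ 0 := by simpa using ha (k - 1)
  have n10 : s ((n + 2 - 2 * k) * h) ≠ 0 := by simpa using hh (n + 2 - 2 * k) (by omega)
  have n11 : s ((n + 1 - 2 * k) * h) ≠ 0 := by simpa using hh (n + 1 - 2 * k) (by omega)
  have n12 : s (a + (3 * k - n - 1) * h) ≠ 0 := by simpa using ha (3 * k - n - 1)
  -- With `cubicCoeff s h a n k` and the common factor `s ((n + 1 + k) * h)` taken out, the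
  -- recursion is exactly this instance.
  have key := hs.interpolate (a + (4 * k + 3) * h) (a + (2 * n + 2) * h) 0
    (-(a + (2 * k + n + 3) * h)) (-(a + k * h))
  rw [show a + (4 * k + 3) * h + 0 = a + (4 * k + 3) * h by ring,
    show a + (2 * n + 2) * h + 0 = a + (2 * n + 2) * h by ring,
    show a + (4 * k + 3) * h + (a + (2 * n + 2) * h) + -(a + (2 * k + n + 3) * h) + -(a + k * h)
      = (n + 2 + k) * h by ring,
    show -(a + (2 * k + n + 3) * h) - -(a + k * h) = -((n + 3 + k) * h) by ring,
    show a + (4 * k + 3) * h + (a + (2 * n + 2) * h) + 0 + -(a + k * h) =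
      a + (2 * n + 5 + 3 * k) * h by ring,
    show 0 - -(a + k * h) = a + k * h by ring,
    show a + (4 * k + 3) * h + -(a + (2 * k + n + 3) * h) = -((n - 2 * k) * h) by ring,
    show a + (2 * n + 2) * h + -(a + (2 * k + n + 3) * h) = (n - 2 * k - 1) * h by ring,
    show a + (4 * k + 3) * h + (a + (2 * n + 2) * h) + 0 + -(a + (2 * k + n + 3) * h) =
      a + (n + 2 + 2 * k) * h by ring,
    show -(a + (2 * k + n + 3) * h) - 0 = -(a + (n + 3 + 2 * k) * h) by ring,
    show a + (4 * k + 3) * h + -(a + k * h) = (3 * k + 3) * h by ring,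
    show a + (2 * n + 2) * h + -(a + k * h) = (2 * n + 2 - k) * h by ring,
    hs.neg, hs.neg, hs.neg] at key
  rw [cubicCoeff_succ hs hh ha', cubicCoeff_shift hs hh ha hk, cubicCoeff_succ hs hh ha,
    show a - h + (4 * k + 4) * h = a + (4 * k + 3) * h by ring,
    show a - h + k * h = a + (k - 1) * h by ring,
    show (((n + 2 : ℕ) : ℂ) - 2 * k) * h = (n + 2 - 2 * k) * h by push_cast; ring,
    show (((n + 2 : ℕ) : ℂ) - 2 * k - 1) * h = (n + 1 - 2 * k) * h by push_cast; ring,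
    show (((n + 2 : ℕ) : ℂ) + 1 + k) * h = (n + 3 + k) * h by push_cast; ring,
    show a - h + 4 * k * h = a + (4 * k - 1) * h by ring,
    show a - h + (((n + 2 : ℕ) : ℂ) + 1 + 2 * k) * h = a + (n + 2 + 2 * k) * h by push_cast; ring,
    show a - h + (((n + 2 : ℕ) : ℂ) + 2 + 2 * k) * h = a + (n + 3 + 2 * k) * h by push_cast; ring,
    show a - h + (2 - ((n + 2 : ℕ) : ℂ) + 3 * k) * h = a + (3 * k - n - 1) * h by push_cast; ring]
  clear ha ha' hh
  generalize cubicCoeff s h a n k = Q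
  generalize s (a + 4 * k * h) = B1 at *
  generalize s (a + (n + 1 + 2 * k) * h) = B2 at *
  generalize s (a + (n + 2 + 2 * k) * h) = B3 at *
  generalize s (a + (n + 3 + 2 * k) * h) = B4 at *
  generalize s (a + (4 * k + 4) * h) = B5 at *
  generalize s ((3 * k + 3) * h) = B6 at *
  generalize s (a + (2 - n + 3 * k) * h) = B7 at *
  generalize s (a + (4 * k - 1) * h) = B8 at *
  generalize s (a + (k - 1) * h) = B9 at *
  generalize s ((n + 2 - 2 * k) * h) = B10 at *
  generalize s ((n + 1 - 2 * k) * h) = B11 at *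
  generalize s (a + (3 * k - n - 1) * h) = B12 at *
  generalize s (a + (4 * k + 3) * h) = C1 at *
  generalize s (a + (2 * n + 2) * h) = C2 at *
  generalize s ((n + 2 + k) * h) = C3 at *
  generalize s ((n + 3 + k) * h) = C4 at *
  generalize s (a + (2 * n + 5 + 3 * k) * h) = C5 at *
  generalize s (a + k * h) = C6 at *
  generalize s ((n - 2 * k) * h) = C7 at *
  generalize s ((n - 2 * k - 1) * h) = C8 at *
  generalize s ((2 * n + 2 - k) * h) = C9 at *
  generalize s ((n + 1 + k) * h) = C10 at *
  have e : C1 * C2 * C3 * C4 / (B1 * B2 * B3 * B4 * B6) = C9 / (B1 * B2) +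
      C5 * C6 * C7 * C8 / (B1 * B2 * B3 * B4 * B6) := by
    field_simp
    linear_combination -key
  have e1 : Q * (B8 * (C10 * C3) * B12 * C2 / (B1 * B9 * (B10 * B11) * B2)) *
      (C1 * B9 * (B10 * B11) * C4 / (B8 * B3 * B4 * B6 * B12)) =
      Q * C10 * (C1 * C2 * C3 * C4 / (B1 * B2 * B3 * B4 * B6)) := by
    field_simp
  have e2 : Q * (B5 * C6 * (C7 * C8) * C10 / (B1 * B2 * B3 * B6 * B7)) * (C5 * B7 / (B4 * B5)) =
      Q * C10 * (C5 * C6 * C7 * C8 / (B1 * B2 * B3 * B4 * B6)) := by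
    field_simp
  rw [e1, e2, e]
  ring

/-- Induction on `N` with `σ`, `b`, `c` fixed. Since `b + c` is fixed, the new factor interpolates
between one extending the `3h`-progressions from `b` and `c` and one extending the `h`-progressions
from `b - σ` and `c - σ`. The parity `ε` lets both kinds of `n` share the proof. -/
theorem cubic_binomial {σ : ℂ} (hσ : ∀ m : ℤ, s (σ + m * h) ≠ 0) {ε : ℕ} (hε : ε ≤ 1) {b c : ℂ}
    (hbc : b + c = 2 * σ + (1 + ε) * h) (N : ℕ) :
    shiftProd s (b - σ + (1 + ε) * h) (3 * h) N * shiftProd s (c - σ + (1 + ε) * h) (3 * h) N =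
      ∑ k ∈ Finset.range (N + 1), cubicCoeff s h (σ - N * h) (2 * N + ε) k *
        (shiftProd s b (3 * h) k * shiftProd s c (3 * h) k *
          (shiftProd s (b - σ) h (N - k) * shiftProd s (c - σ) h (N - k))) := by
  induction N with
  | zero =>
    have h0 : s (σ + h) ≠ 0 := by simpa using hσ 1
    have h1 : s σ ≠ 0 := by simpa using hσ 0
    interval_cases ε
    · simp [cubicCoeff, shiftProd_zero, h1]
    · have e : σ + (2 - 1) * h = σ + h := by ring
      simp [cubicCoeff, shiftProd_zero, shiftProd_one, h1, h0, e]
  | succ N ih =>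
    set a := σ - N * h with ha_def
    set n := 2 * N + ε with hn
    have hnC : (n : ℂ) = 2 * N + ε := by rw [hn]; push_cast; ring
    have ha : ∀ m : ℤ, s (a + m * h) ≠ 0 := fun m => by
      have := hσ (m - N)
      convert this using 2
      rw [ha_def]
      push_cast
      ring
    have ea : σ - ((N + 1 : ℕ) : ℂ) * h = a - h := by rw [ha_def]; push_cast; ring
    have en : 2 * (N + 1) + ε = n + 2 := by omega
    rw [ea, en]
    set W : ℕ → ℕ → ℂ := fun N k => shiftProd s b (3 * h) k * shiftProd s c (3 * h) k *
      (shiftProd s (b - σ) h (N - k) * shiftProd s (c - σ) h (N - k)) with hW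
    -- `A` and `B` are at once the weights of the Pascal rule and those of the interpolation; their
    -- agreement closes the induction.
    set A : ℕ → ℂ := fun k => s ((2 * n + 2 - k) * h) * s ((n + 1 + k) * h) /
      (s (a + (n + 1 + 2 * k) * h) * s (a + 4 * k * h)) with hA
    set B : ℕ → ℂ := fun k => s (a + (2 * n + 2 + 3 * k) * h) * s (a + (3 * k - n - 1) * h) /
      (s (a + (n + 1 + 2 * k) * h) * s (a + 4 * k * h)) with hB
    have p0 : cubicCoeff s h (a - h) (n + 2) 0 = cubicCoeff s h a n 0 * B 0 := by
      rw [cubicCoeff_shift_zero hs hh ha]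
      simp [hB, sub_eq_add_neg]
    have p1 : ∀ k ∈ Finset.range (N + 1), cubicCoeff s h (a - h) (n + 2) (k + 1) =
        cubicCoeff s h a n k * A k + cubicCoeff s h a n (k + 1) * B (k + 1) := by
      intro k hk
      rw [Finset.mem_range] at hk
      rw [cubicCoeff_pascal hs hh ha (by omega)]
      simp only [hA, hB]
      push_cast
      ring_nf
    have p2 : ∀ k ∈ Finset.range (N + 1), A k * W (N + 1) (k + 1) + B k * W (N + 1) k =
        s (b - σ + (1 + ε) * h + N * (3 * h)) * s (c - σ + (1 + ε) * h + N * (3 * h)) *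
          W N k := by
      intro k hk
      rw [Finset.mem_range] at hk
      have n1 : s (a + (n + 1 + 2 * k) * h) ≠ 0 := by simpa using ha (n + 1 + 2 * k)
      have n2 : s (a + 4 * k * h) ≠ 0 := by simpa using ha (4 * k)
      have key := hs.interpolate b c (-σ + (1 + ε + 3 * N) * h) (3 * k * h) (-σ + (N - k) * h)
      rw [hbc, show 2 * σ + (1 + ε) * h + 3 * k * h + (-σ + (N - k) * h) =
          a + (n + 1 + 2 * k) * h by rw [ha_def, hnC]; ring,
        show 3 * k * h - (-σ + (N - k) * h) = a + 4 * k * h by rw [ha_def]; ring,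
        show 2 * σ + (1 + ε) * h + (-σ + (1 + ε + 3 * N) * h) + (-σ + (N - k) * h) =
          (2 * n + 2 - k) * h by rw [hnC]; ring,
        show -σ + (1 + ε + 3 * N) * h - (-σ + (N - k) * h) = (n + 1 + k) * h by rw [hnC]; ring,
        show 2 * σ + (1 + ε) * h + (-σ + (1 + ε + 3 * N) * h) + 3 * k * h =
          a + (2 * n + 2 + 3 * k) * h by rw [ha_def, hnC]; ring,
        show 3 * k * h - (-σ + (1 + ε + 3 * N) * h) = a + (3 * k - n - 1) * h by
          rw [ha_def, hnC]; ring,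
        show b + (-σ + (1 + ε + 3 * N) * h) = b - σ + (1 + ε) * h + N * (3 * h) by ring,
        show c + (-σ + (1 + ε + 3 * N) * h) = c - σ + (1 + ε) * h + N * (3 * h) by ring,
        show b + (-σ + (N - k) * h) = b - σ + (N - k : ℕ) * h by
          rw [Nat.cast_sub (by omega)]; ring,
        show c + (-σ + (N - k) * h) = c - σ + (N - k : ℕ) * h by
          rw [Nat.cast_sub (by omega)]; ring,
        show b + 3 * k * h = b + k * (3 * h) by ring,
        show c + 3 * k * h = c + k * (3 * h) by ring] at key
      have key' : s (b - σ + (1 + ε) * h + N * (3 * h)) * s (c - σ + (1 + ε) * h + N * (3 * h)) =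
          A k * (s (b + k * (3 * h)) * s (c + k * (3 * h))) +
          B k * (s (b - σ + (N - k : ℕ) * h) * s (c - σ + (N - k : ℕ) * h)) := by
        rw [div_mul_eq_mul_div, div_mul_eq_mul_div, ← add_div, eq_div_iff (mul_ne_zero n1 n2)]
        exact key
      rw [key']
      simp only [hW]
      rw [show N + 1 - (k + 1) = N - k by omega, show N + 1 - k = N - k + 1 by omega,
        shiftProd_succ, shiftProd_succ, shiftProd_succ, shiftProd_succ]
      ring
    have p3 : cubicCoeff s h a n (N + 1) = 0 := cubicCoeff_eq_zero hs a (by omega)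
    have p4 : ∑ k ∈ Finset.range (N + 1),
        cubicCoeff s h (a - h) (n + 2) (k + 1) * W (N + 1) (k + 1) =
        ∑ k ∈ Finset.range (N + 1), cubicCoeff s h a n k * A k * W (N + 1) (k + 1) +
        ∑ k ∈ Finset.range (N + 1), cubicCoeff s h a n (k + 1) * B (k + 1) * W (N + 1) (k + 1) := by
      rw [← Finset.sum_add_distrib]
      exact Finset.sum_congr rfl fun k hk => by rw [p1 k hk, add_mul]
    have p5 : ∑ k ∈ Finset.range (N + 1),
        cubicCoeff s h a n (k + 1) * B (k + 1) * W (N + 1) (k + 1) +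
        cubicCoeff s h a n 0 * B 0 * W (N + 1) 0 =
        ∑ k ∈ Finset.range (N + 1), cubicCoeff s h a n k * B k * W (N + 1) k := by
      rw [← Finset.sum_range_succ' (fun k => cubicCoeff s h a n k * B k * W (N + 1) k) (N + 1),
        Finset.sum_range_succ _ (N + 1), p3, zero_mul, zero_mul, add_zero]
    have p6 : (∑ k ∈ Finset.range (N + 1), cubicCoeff s h a n k * W N k) *
        (s (b - σ + (1 + ε) * h + N * (3 * h)) * s (c - σ + (1 + ε) * h + N * (3 * h))) =
        ∑ k ∈ Finset.range (N + 1), cubicCoeff s h a n k * A k * W (N + 1) (k + 1) +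
        ∑ k ∈ Finset.range (N + 1), cubicCoeff s h a n k * B k * W (N + 1) k := by
      rw [← Finset.sum_add_distrib, Finset.sum_mul]
      refine Finset.sum_congr rfl fun k hk => ?_
      have := p2 k hk
      linear_combination -cubicCoeff s h a n k * this
    change _ = ∑ k ∈ Finset.range (N + 1), cubicCoeff s h a n k * W N k at ih
    rw [shiftProd_succ, shiftProd_succ, mul_mul_mul_comm, ih, Finset.sum_range_succ' _ (N + 1)]
    change _ = ∑ k ∈ Finset.range (N + 1),
      cubicCoeff s h (a - h) (n + 2) (k + 1) * W (N + 1) (k + 1) +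
        cubicCoeff s h (a - h) (n + 2) 0 * W (N + 1) 0
    rw [p4, p0, p6]
    linear_combination -p5

end Cubic

/-- The part of the summand of the cubic transformation that does not involve `d` and `e`. -/
noncomputable def cubicBase (s : ℂ → ℂ) (h a b c : ℂ) (n k : ℕ) : ℂ :=
  s (a + 4 * k * h) / s a *
    (shiftProd s b (3 * h) k * shiftProd s c (3 * h) k /
      (shiftProd s (a + h - b) h k * shiftProd s (a + h - c) h k)) *
    (shiftProd s (-(n * h)) h (2 * k) / shiftProd s (a + (n + 1) * h) h (2 * k))

/-- The remaining factor of the summand in the summable case `d = a`, `e = q^(n+1)`. -/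
noncomputable def cubicRest (s : ℂ → ℂ) (h a : ℂ) (n k : ℕ) : ℂ :=
  shiftProd s a h k * shiftProd s ((n + 1) * h) h k /
    (shiftProd s (3 * h) (3 * h) k * shiftProd s (a + (2 - n) * h) (3 * h) k)

/-- The closed form of the cubic sum. -/
noncomputable def cubicValue (s : ℂ → ℂ) (h a b : ℂ) (n : ℕ) : ℂ :=
  shiftProd s (a + h) h n * shiftProd s (a + (2 - n) * h - b) (3 * h) n /
    (shiftProd s (a + h - b) h n * shiftProd s (a + (2 - n) * h) (3 * h) n)

section Cubic

variable {s : ℂ → ℂ} (hs : IsThetaLike s) {h : ℂ} (hh : ∀ m : ℤ, m ≠ 0 → s (m * h) ≠ 0)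
include hs hh

omit hh in
-- Trades the products of length `N - k` in `cubic_binomial` for denominators of length `k`.
theorem shiftProd_split_reflect (b σ : ℂ) {N k : ℕ} (hk : k ≤ N) :
    shiftProd s (b - σ) h N =
      shiftProd s (b - σ) h (N - k) * ((-1) ^ k * shiftProd s (σ - N * h + h - b) h k) := by
  obtain ⟨m, rfl⟩ := Nat.exists_eq_add_of_le' hk
  rw [Nat.add_sub_cancel, shiftProd_add, shiftProd_reflect hs (b - σ + m * h)]
  congr 3
  push_cast
  ring

/-- This is `cubic_binomial` divided by its `k = 0` products `(b - σ)_N (c - σ)_N`, with the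
reflected factors rewritten as denominators. -/
theorem cubic_sum {a b c : ℂ} {n : ℕ} (ha : ∀ m : ℤ, s (a + m * h) ≠ 0)
    (hab : ∀ m : ℤ, s (a - b + m * h) ≠ 0) (hbc : b + c = 2 * a + (n + 1) * h) :
    ∑ k ∈ Finset.range (n / 2 + 1), cubicBase s h a b c n k * cubicRest s h a n k =
      cubicValue s h a b n := by
  obtain ⟨N, ε, hε, rfl⟩ : ∃ N ε, ε ≤ 1 ∧ n = 2 * N + ε := ⟨n / 2, n % 2, by omega, by omega⟩
  have hN : (2 * N + ε) / 2 = N := by omega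
  rw [hN]
  set σ := a + N * h with hσ_def
  have ea : σ - N * h = a := by rw [hσ_def]; ring
  have hσ : ∀ m : ℤ, s (σ + m * h) ≠ 0 := fun m => by
    have := ha (m + N)
    convert this using 2
    rw [hσ_def]; push_cast; ring
  have hc : c = 2 * a + (2 * N + ε + 1) * h - b := by push_cast at hbc; linear_combination hbc
  have key := cubic_binomial hs hh hσ hε (b := b) (c := c) (by rw [hσ_def, hc]; ring) N
  rw [ea] at key
  have nb : ∀ k, shiftProd s (a + h - b) h k ≠ 0 := fun k =>
    shiftProd_lattice_ne_zero hab (m := 1) (j := 1) (by push_cast; ring) (by simp) k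
  have nc : ∀ k, shiftProd s (a + h - c) h k ≠ 0 := fun k => by
    refine shiftProd_ne_zero fun i _ hz => hab (2 * N + ε - i) ?_
    rw [show a - b + ((2 * N + ε - i : ℤ) : ℂ) * h = -(a + h - c + i * h) by
      rw [hc]; push_cast; ring, hs.neg, hz, neg_zero]
  have n1 : shiftProd s (a + h) h (2 * N + ε) ≠ 0 :=
    shiftProd_lattice_ne_zero ha (m := 1) (j := 1) (by simp) (by simp) _
  have n2 : shiftProd s (a + (2 - ((2 * N + ε : ℕ) : ℂ)) * h) (3 * h) (2 * N + ε) ≠ 0 :=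
    shiftProd_lattice_ne_zero ha (m := 2 - (2 * N + ε)) (j := 3) (by push_cast; ring) (by simp) _
  have sgn : ∀ k : ℕ, ((-1 : ℂ) ^ k) * (-1) ^ k = 1 := fun k => by rw [← mul_pow]; simp
  have eb : shiftProd s (b - σ) h N = (-1) ^ N * shiftProd s (a + h - b) h N := by
    rw [shiftProd_split_reflect hs b σ le_rfl, ea, Nat.sub_self, shiftProd_zero, one_mul]
  have ec : shiftProd s (c - σ) h N = (-1) ^ N * shiftProd s (a + h - c) h N := by
    rw [shiftProd_split_reflect hs c σ le_rfl, ea, Nat.sub_self, shiftProd_zero, one_mul]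
  set M := shiftProd s (b - σ) h N * shiftProd s (c - σ) h N with hM
  have hM0 : M ≠ 0 := by
    rw [hM, eb, ec]
    exact mul_ne_zero (mul_ne_zero (pow_ne_zero _ (by norm_num)) (nb N))
      (mul_ne_zero (pow_ne_zero _ (by norm_num)) (nc N))
  have hterm : ∀ k ∈ Finset.range (N + 1),
      cubicBase s h a b c (2 * N + ε) k * cubicRest s h a (2 * N + ε) k =
      shiftProd s (a + h) h (2 * N + ε) /
        (M * shiftProd s (a + (2 - ((2 * N + ε : ℕ) : ℂ)) * h) (3 * h) (2 * N + ε)) *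
      (cubicCoeff s h a (2 * N + ε) k * (shiftProd s b (3 * h) k * shiftProd s c (3 * h) k *
          (shiftProd s (b - σ) h (N - k) * shiftProd s (c - σ) h (N - k)))) := by
    intro k hk
    have hk' : k ≤ N := by rw [Finset.mem_range] at hk; omega
    have eM : shiftProd s (b - σ) h (N - k) * shiftProd s (c - σ) h (N - k) =
        M / (shiftProd s (a + h - b) h k * shiftProd s (a + h - c) h k) := by
      rw [eq_div_iff (mul_ne_zero (nb k) (nc k)), hM, shiftProd_split_reflect hs b σ hk',
        shiftProd_split_reflect hs c σ hk', ea]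
      linear_combination -shiftProd s (b - σ) h (N - k) * shiftProd s (c - σ) h (N - k) *
        shiftProd s (a + h - b) h k * shiftProd s (a + h - c) h k * sgn k
    rw [eM, cubicBase, cubicRest, cubicCoeff]
    generalize shiftProd s (a + (2 - ((2 * N + ε : ℕ) : ℂ)) * h) (3 * h) (2 * N + ε) = A1 at *
    generalize shiftProd s (a + h) h (2 * N + ε) = A2 at *
    have e1 : ∀ x : ℂ, x = A2 / (M * A1) * (x * (A1 / A2) * M) := fun x => by field_simp
    rw [e1 (s (a + 4 * k * h) / s a * _ * _ * _)]
    ring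
  rw [Finset.sum_congr rfl hterm, ← Finset.mul_sum, ← key, cubicValue]
  -- By the relation between `b` and `c`, the last `N` factors form the progression starting at `c -
  -- σ`. For odd `n` one middle factor is left over; it cancels against the one in `e2`.
  have e1 : shiftProd s (a + h - b) h (2 * N + ε) =
      (-1) ^ N * (M * shiftProd s (a + h - b + N * h) h ε) := by
    rw [show 2 * N + ε = N + ε + N by ring, shiftProd_add, shiftProd_add,
      show a + h - b + ((N + ε : ℕ) : ℂ) * h = c - σ by rw [hc, hσ_def]; push_cast; ring, hM, eb]
    linear_combination -shiftProd s (a + h - b) h N * shiftProd s (a + h - b + N * h) h ε *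
      shiftProd s (c - σ) h N * sgn N
  have e2 : shiftProd s (a + (2 - ((2 * N + ε : ℕ) : ℂ)) * h - b) (3 * h) (2 * N + ε) =
      (-1) ^ N * (shiftProd s (b - σ + (1 + ε) * h) (3 * h) N *
        shiftProd s (c - σ + (1 + ε) * h) (3 * h) N * shiftProd s (a + h - b + N * h) h ε) := by
    nth_rewrite 2 [show 2 * N + ε = N + ε + N by ring]
    rw [shiftProd_add, shiftProd_add, shiftProd_reflect hs _ _ N,
      show -(a + (2 - ((2 * N + ε : ℕ) : ℂ)) * h - b + (N - 1) * (3 * h)) =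
        b - σ + (1 + ε) * h by rw [hσ_def]; push_cast; ring,
      show a + (2 - ((2 * N + ε : ℕ) : ℂ)) * h - b + ((N + ε : ℕ) : ℂ) * (3 * h) =
        c - σ + (1 + ε) * h by rw [hc, hσ_def]; push_cast; ring]
    have e3 : shiftProd s (a + (2 - ((2 * N + ε : ℕ) : ℂ)) * h - b + N * (3 * h)) (3 * h) ε =
        shiftProd s (a + h - b + N * h) h ε := by
      interval_cases ε
      · rfl
      · rw [shiftProd_one, shiftProd_one]
        congr 1
        push_cast
        ring
    rw [e3]
    ring
  have n3 : shiftProd s (a + h - b + N * h) h ε ≠ 0 :=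
    shiftProd_lattice_ne_zero hab (m := 1 + N) (j := 1) (by push_cast; ring) (by simp) _
  have n4 : ((-1 : ℂ)) ^ N ≠ 0 := pow_ne_zero _ (by norm_num)
  rw [e1, e2]
  generalize shiftProd s (a + h - b + N * h) h ε = A1 at *
  generalize (-1 : ℂ) ^ N = A2 at *
  generalize shiftProd s (a + (2 - ((2 * N + ε : ℕ) : ℂ)) * h) (3 * h) (2 * N + ε) = A3 at *
  clear_value M
  field_simp

end Cubic

/-! ### Partial fractions and the reduction to the summable case -/

/-- Elliptic partial fractions for `u ↦ s (b + u) s (c + u)` with `b + c` fixed. -/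
theorem IsThetaLike.partial_fractions {s : ℂ → ℂ} (hs : IsThetaLike s) (Λ : ℂ) (w v : ℕ → ℂ)
    (k : ℕ) (hv : ∀ i ≤ k, ∀ j ≤ k, i ≠ j → s (Λ + v i + v j) * s (v i - v j) ≠ 0) :
    ∀ b c : ℂ, b + c = Λ → (∀ j ≤ k, s (b + v j) * s (c + v j) ≠ 0) →
    (∏ i ∈ Finset.range k, (s (b + w i) * s (c + w i))) /
        ∏ j ∈ Finset.range (k + 1), (s (b + v j) * s (c + v j)) =
      ∑ j ∈ Finset.range (k + 1),
        (∏ i ∈ Finset.range k, (s (Λ + w i + v j) * s (w i - v j))) /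
          (∏ l ∈ Finset.range (k + 1),
            if l = j then 1 else s (Λ + v l + v j) * s (v l - v j)) /
          (s (b + v j) * s (c + v j)) := by
  induction k with
  | zero => intro b c _ _; simp
  | succ k ih =>
    have ih' := ih fun i hi j hj => hv i (by omega) j (by omega)
    intro b c hbc hD
    set z := v (k + 1) with hz
    have hzD : s (b + z) * s (c + z) ≠ 0 := hD (k + 1) le_rfl
    have h1 := ih' b c hbc fun j hj => hD j (Nat.le_succ_of_le hj)
    -- The coefficient at the new pole `z` is read off from the previous expansion evaluated at `b =
    -- -z`, `c = Λ + z`.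
    have h2 := ih' (-z) (Λ + z) (by ring) fun j (hj : j ≤ k) => by
      have := hv j (by omega) (k + 1) le_rfl (by omega)
      rw [← hz] at this
      rwa [neg_add_eq_sub, show Λ + z + v j = Λ + v j + z by ring, mul_comm]
    rw [Finset.prod_range_succ, Finset.prod_range_succ _ (k + 1), Finset.sum_range_succ _ (k + 1),
      mul_div_mul_comm, h1, Finset.sum_mul]
    have hlast : (∏ i ∈ Finset.range (k + 1), (s (Λ + w i + z) * s (w i - z))) /
          (∏ l ∈ Finset.range (k + 1 + 1),
            if l = k + 1 then 1 else s (Λ + v l + z) * s (v l - z)) =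
        s (Λ + w k + z) * s (w k - z) *
        ∑ j ∈ Finset.range (k + 1),
          (∏ i ∈ Finset.range k, (s (Λ + w i + v j) * s (w i - v j))) /
          (∏ l ∈ Finset.range (k + 1),
            if l = j then 1 else s (Λ + v l + v j) * s (v l - v j)) /
          (s (Λ + v j + z) * s (v j - z)) := by
      have e : ∀ u, s (-z + u) * s (Λ + z + u) = s (Λ + u + z) * s (u - z) := fun u => by
        rw [neg_add_eq_sub, show Λ + z + u = Λ + u + z by ring, mul_comm]
      simp only [e] at h2
      rw [← h2, Finset.prod_range_succ (fun i => s (Λ + w i + z) * s (w i - z)) k,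
        Finset.prod_range_succ _ (k + 1), if_pos rfl, mul_one,
        mul_comm _ (s (Λ + w k + z) * s (w k - z)), mul_div_assoc]
      refine congrArg _ (congrArg _ (Finset.prod_congr rfl fun l hl => ?_))
      rw [Finset.mem_range] at hl
      rw [if_neg (by omega)]
    rw [← hz, hlast, Finset.mul_sum, Finset.sum_div, ← Finset.sum_add_distrib]
    refine Finset.sum_congr rfl fun j hj => ?_
    rw [Finset.mem_range] at hj
    have hjD := hD j (by omega)
    have hjz := hv j (by omega) (k + 1) le_rfl (by omega)
    have hzj := hv (k + 1) le_rfl j (by omega) (by omega)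
    rw [← hz] at hjz hzj
    rw [Finset.prod_range_succ (fun i => s (Λ + w i + v j) * s (w i - v j)) k,
      Finset.prod_range_succ (fun l => if l = j then 1 else s (Λ + v l + v j) * s (v l - v j))
        (k + 1), if_neg (by omega), ← hz]
    have key := hs.interpolate b c (w k) (v j) z
    rw [hbc] at key
    have k1 : s (v j - w k) = -s (w k - v j) := by rw [← hs.neg]; congr 1; ring
    have k2 : s (z - v j) = -s (v j - z) := by rw [← hs.neg]; congr 1; ring
    rw [k1] at key
    rw [k2] at hzj ⊢
    have k3 : s (Λ + z + v j) = s (Λ + v j + z) := by congr 1; ring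
    rw [k3] at hzj ⊢
    generalize (∏ i ∈ Finset.range k, (s (Λ + w i + v j) * s (w i - v j))) = P1
    generalize (∏ l ∈ Finset.range (k + 1),
            if l = j then 1 else s (Λ + v l + v j) * s (v l - v j)) = P2
    have n1 := left_ne_zero_of_mul hjz
    have n2 := right_ne_zero_of_mul hjz
    have n3 := left_ne_zero_of_mul hjD
    have n4 := right_ne_zero_of_mul hjD
    have n5 := left_ne_zero_of_mul hzD
    have n6 := right_ne_zero_of_mul hzD
    clear hzj hjz hjD hzD hlast h1 h2 ih ih' hD hv k1 k2 k3
    generalize s (Λ + v j + z) = A1 at *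
    generalize s (v j - z) = A2 at *
    generalize s (b + v j) = A3 at *
    generalize s (c + v j) = A4 at *
    generalize s (b + z) = A5 at *
    generalize s (c + z) = A6 at *
    -- Splits a term with the two poles `v j` and `z` into terms with one pole each.
    have e : s (b + w k) * s (c + w k) / (A5 * A6) / (A3 * A4) =
        s (Λ + w k + v j) * s (w k - v j) / (A1 * -A2) / (A3 * A4) +
        s (Λ + w k + z) * s (w k - z) / (A1 * A2) / (A5 * A6) := by
      field_simp
      linear_combination key
    calc _ = P1 / P2 * (s (b + w k) * s (c + w k) / (A5 * A6) / (A3 * A4)) := by ring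
      _ = _ := by rw [e]; ring

/-- The factor of the summand of the cubic transformation that involves `d` and `e`. -/
noncomputable def cubicDE (s : ℂ → ℂ) (h a d e : ℂ) (k : ℕ) : ℂ :=
  shiftProd s d h k * shiftProd s e h k /
    (shiftProd s (a + 3 * h - d) (3 * h) k * shiftProd s (a + 3 * h - e) (3 * h) k)

/-- The coefficients of the partial fraction expansion of `cubicDE`. -/
noncomputable def cubicPF (s : ℂ → ℂ) (h a : ℂ) (n k j : ℕ) : ℂ :=
  (∏ i ∈ Finset.range k, (s (a + 3 * j * h + i * h) * s ((n + 1 - 3 * j) * h + i * h))) /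
    ∏ l ∈ Finset.range (k + 1),
      if l = j then 1 else s (a + (3 * l + 3 * j - n - 1) * h) * s ((3 * l - 3 * j) * h)

/-- The part of `cubicPF` that depends on the second index only. -/
noncomputable def cubicPFHead (s : ℂ → ℂ) (h a : ℂ) (n j : ℕ) : ℂ :=
  shiftProd s (a + 3 * j * h) h j * shiftProd s ((n + 1 - 3 * j) * h) h j /
    (shiftProd s (a + (3 * j - n - 1) * h) (3 * h) j * shiftProd s (-(3 * j * h)) (3 * h) j)

/-- The summand of the very-well-poised series in the cubic transformation. -/
noncomputable def cubicOmega (s : ℂ → ℂ) (h a b c d e : ℂ) (n j : ℕ) : ℂ :=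
  s (a - (n + 1) * h + 6 * j * h) / s (a - (n + 1) * h) *
    (shiftProd s (a - (n + 1) * h) (3 * h) j * (shiftProd s b (3 * h) j * shiftProd s c (3 * h) j) *
      (shiftProd s (a - d) (3 * h) j * shiftProd s (a - e) (3 * h) j) *
      (shiftProd s ((2 - n) * h) (3 * h) j * shiftProd s ((1 - n) * h) (3 * h) j *
        shiftProd s (-(n * h)) (3 * h) j) /
    (shiftProd s (3 * h) (3 * h) j *
      (shiftProd s (a + (2 - n) * h - b) (3 * h) j *
        shiftProd s (a + (2 - n) * h - c) (3 * h) j) *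
      (shiftProd s (d + (2 - n) * h) (3 * h) j * shiftProd s (e + (2 - n) * h) (3 * h) j) *
      (shiftProd s a (3 * h) j * shiftProd s (a + h) (3 * h) j *
        shiftProd s (a + 2 * h) (3 * h) j)))

theorem shiftProd_trisect (s : ℂ → ℂ) (x h : ℂ) (j : ℕ) :
    shiftProd s x h (3 * j) = shiftProd s x (3 * h) j * shiftProd s (x + h) (3 * h) j *
      shiftProd s (x + 2 * h) (3 * h) j := by
  induction j with
  | zero => simp [shiftProd_zero]
  | succ j ih =>
    rw [show 3 * (j + 1) = 3 * j + 1 + 1 + 1 by ring]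
    simp only [shiftProd_succ, ih]
    rw [show x + (3 * j : ℕ) * h = x + j * (3 * h) by push_cast; ring,
      show x + (3 * j + 1 : ℕ) * h = x + h + j * (3 * h) by push_cast; ring,
      show x + (3 * j + 1 + 1 : ℕ) * h = x + 2 * h + j * (3 * h) by push_cast; ring]
    ring

/-- The shift to `a + 4jh`, `b + 3jh`, `c + 3jh`, `n - 2j` preserves the balancing condition, so
`cubic_sum` applies to the tail. -/
theorem cubicBase_add {s : ℂ → ℂ} {h a : ℂ} (ha : ∀ m : ℤ, s (a + m * h) ≠ 0) (b c : ℂ)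
    (n j i : ℕ) : cubicBase s h a b c (n + 2 * j) (j + i) =
      cubicBase s h a b c (n + 2 * j) j *
        cubicBase s h (a + 4 * j * h) (b + 3 * j * h) (c + 3 * j * h) n i := by
  have n1 : s (a + 4 * j * h) ≠ 0 := by simpa using ha (4 * j)
  simp only [cubicBase]
  rw [mul_add 2 j i]
  simp only [shiftProd_add]
  rw [show a + 4 * ((j + i : ℕ) : ℂ) * h = a + 4 * j * h + 4 * i * h by push_cast; ring,
    show b + j * (3 * h) = b + 3 * j * h by ring, show c + j * (3 * h) = c + 3 * j * h by ring,
    show a + h - b + j * h = a + 4 * j * h + h - (b + 3 * j * h) by ring,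
    show a + h - c + j * h = a + 4 * j * h + h - (c + 3 * j * h) by ring,
    show -(((n + 2 * j : ℕ) : ℂ) * h) + (2 * j : ℕ) * h = -(n * h) by push_cast; ring,
    show a + (((n + 2 * j : ℕ) : ℂ) + 1) * h + (2 * j : ℕ) * h = a + 4 * j * h + (n + 1) * h by
      push_cast; ring]
  have e : ∀ x y : ℂ, x / y = s (a + 4 * j * h) / y * (x / s (a + 4 * j * h)) := fun x y => by
    field_simp
  rw [e (s (a + 4 * j * h + 4 * i * h)) (s a)]
  ring

/-- The dependence on `i` is exactly the factor completing the shifted `cubicBase` to the summand of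
`cubic_sum`. -/
theorem cubicPF_add (s : ℂ → ℂ) (h a : ℂ) (n j i : ℕ) : cubicPF s h a (n + 2 * j) (j + i) j =
    cubicPFHead s h a (n + 2 * j) j * cubicRest s h (a + 4 * j * h) n i := by
  have e1 : (∏ i ∈ Finset.range (j + i), (s (a + 3 * j * h + i * h) *
      s ((((n + 2 * j : ℕ) : ℂ) + 1 - 3 * j) * h + i * h))) =
      shiftProd s (a + 3 * j * h) h j * shiftProd s (a + 4 * j * h) h i *
      (shiftProd s ((((n + 2 * j : ℕ) : ℂ) + 1 - 3 * j) * h) h j *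
        shiftProd s ((n + 1) * h) h i) := by
    rw [Finset.prod_mul_distrib]
    change shiftProd s _ _ _ * shiftProd s _ _ _ = _
    rw [shiftProd_add, shiftProd_add, show a + 3 * j * h + j * h = a + 4 * j * h by ring,
      show (((n + 2 * j : ℕ) : ℂ) + 1 - 3 * j) * h + j * h = (n + 1) * h by push_cast; ring]
  have e2 : (∏ l ∈ Finset.range (j + i + 1), if l = j then 1 else
      s (a + (3 * l + 3 * j - ((n + 2 * j : ℕ) : ℂ) - 1) * h) * s ((3 * l - 3 * j) * h)) =
      (shiftProd s (a + (3 * j - ((n + 2 * j : ℕ) : ℂ) - 1) * h) (3 * h) j *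
        shiftProd s (-(3 * j * h)) (3 * h) j) *
      (shiftProd s (a + 4 * j * h + (2 - n) * h) (3 * h) i * shiftProd s (3 * h) (3 * h) i) := by
    rw [add_assoc, Finset.prod_range_add, Finset.prod_range_succ']
    simp only [add_zero, if_true, mul_one, shiftProd, ← Finset.prod_mul_distrib]
    refine congrArg₂ _ (Finset.prod_congr rfl fun l hl => ?_)
      (Finset.prod_congr rfl fun l _ => ?_)
    · rw [Finset.mem_range] at hl
      rw [if_neg (by omega)]
      congr 2 <;> ring
    · rw [if_neg (by omega)]
      congr 2 <;> push_cast <;> ring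
  rw [cubicPF, e1, e2, cubicPFHead, cubicRest]
  ring

section Cubic

variable {s : ℂ → ℂ} (hs : IsThetaLike s) {h : ℂ} (hh : ∀ m : ℤ, m ≠ 0 → s (m * h) ≠ 0)
include hs

/-- For `3j > n` the progression from `(n + 1 - 3j) h` passes through `0` within `j` steps; hence
the outer sum stops at `n / 3`. -/
theorem cubicPFHead_eq_zero (a : ℂ) {n j : ℕ} (hj : 2 * j ≤ n) (hj' : n < 3 * j) :
    cubicPFHead s h a n j = 0 := by
  have : shiftProd s ((n + 1 - 3 * j) * h) h j = 0 := by
    have := shiftProd_neg_eq_zero (h := h) hs (n := 3 * j - n - 1) (k := j) (by omega)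
    rw [← this]
    congr 1
    rw [Nat.sub_sub, Nat.cast_sub (by omega)]
    push_cast
    ring
  rw [cubicPFHead, this, mul_zero, zero_div]

include hh

theorem cubicDE_eq_sum {a d e : ℂ} {n : ℕ} (ha : ∀ m : ℤ, s (a + m * h) ≠ 0)
    (hd : ∀ m : ℤ, s (d + m * h) ≠ 0) (he : ∀ m : ℤ, s (e + m * h) ≠ 0)
    (hde : d + e = a + (n + 1) * h) (k : ℕ) :
    cubicDE s h a d e k = ∑ j ∈ Finset.range (k + 1), cubicPF s h a n k j *
      (s (d - (n + 1) * h) * s (e - (n + 1) * h) /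
        (s (d + (3 * j - n - 1) * h) * s (e + (3 * j - n - 1) * h))) := by
  have hD : ∀ j : ℕ, s (d + (3 * j - n - 1) * h) * s (e + (3 * j - n - 1) * h) ≠ 0 := fun j => by
    refine mul_ne_zero ?_ ?_
    · simpa using hd (3 * j - n - 1)
    · simpa using he (3 * j - n - 1)
  have key := hs.partial_fractions (a + (n + 1) * h) (fun i => i * h)
    (fun j => (3 * j - n - 1) * h) k (fun i _ j _ hij => by
      refine mul_ne_zero ?_ ?_
      · have := ha (3 * i + 3 * j - n - 1)
        convert this using 2
        push_cast
        ring
      · have := hh (3 * i - 3 * j) (by omega)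
        convert this using 2
        push_cast
        ring) d e hde (fun j _ => hD j)
  have hPF : ∀ j : ℕ, (∏ i ∈ Finset.range k, (s (a + (n + 1) * h + i * h + (3 * j - n - 1) * h) *
        s (i * h - (3 * j - n - 1) * h))) /
          (∏ l ∈ Finset.range (k + 1), if l = j then 1 else
            s (a + (n + 1) * h + (3 * l - n - 1) * h + (3 * j - n - 1) * h) *
              s ((3 * l - n - 1) * h - (3 * j - n - 1) * h)) = cubicPF s h a n k j := by
    intro j
    rw [cubicPF]
    refine congrArg₂ _ (Finset.prod_congr rfl fun i _ => ?_) (Finset.prod_congr rfl fun l _ => ?_)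
    · congr 2 <;> ring
    · congr 3 <;> ring
  simp only [hPF] at key
  -- Partial fractions need one more pole than zeros: the pole `j = 0` is supplied by multiplying
  -- and dividing by its factor. The others are the denominators of `cubicDE`, rewritten by means of
  -- `hde`.
  have e1 : cubicDE s h a d e k = s (d - (n + 1) * h) * s (e - (n + 1) * h) *
      ((∏ i ∈ Finset.range k, (s (d + i * h) * s (e + i * h))) /
        ∏ j ∈ Finset.range (k + 1),
          (s (d + (3 * j - n - 1) * h) * s (e + (3 * j - n - 1) * h))) := by
    have h0 := hD 0
    rw [Finset.prod_range_succ', Finset.prod_mul_distrib, Finset.prod_mul_distrib]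
    have e2 : ∏ i ∈ Finset.range k, s (d + (3 * ((i + 1 : ℕ) : ℂ) - n - 1) * h) =
        shiftProd s (a + 3 * h - e) (3 * h) k := by
      refine Finset.prod_congr rfl fun i _ => ?_
      congr 1
      push_cast
      linear_combination hde
    have e3 : ∏ i ∈ Finset.range k, s (e + (3 * ((i + 1 : ℕ) : ℂ) - n - 1) * h) =
        shiftProd s (a + 3 * h - d) (3 * h) k := by
      refine Finset.prod_congr rfl fun i _ => ?_
      congr 1
      push_cast
      linear_combination hde
    rw [e2, e3]
    rw [show d + (3 * ((0 : ℕ) : ℂ) - n - 1) * h = d - (n + 1) * h by push_cast; ring,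
      show e + (3 * ((0 : ℕ) : ℂ) - n - 1) * h = e - (n + 1) * h by push_cast; ring] at h0 ⊢
    have n1 := left_ne_zero_of_mul h0
    have n2 := right_ne_zero_of_mul h0
    rw [cubicDE]
    change _ = _ * (shiftProd s d h k * shiftProd s e h k / _)
    generalize s (d - (n + 1) * h) = A1 at *
    generalize s (e - (n + 1) * h) = A2 at *
    field_simp
  rw [e1, key, Finset.mul_sum]
  refine Finset.sum_congr rfl fun j _ => ?_
  ring

end Cubic

/-! ### Matching the evaluated inner sums with the very-well-poised series -/

section Cubic

variable {s : ℂ → ℂ} (hs : IsThetaLike s) {h : ℂ} (hh : ∀ m : ℤ, m ≠ 0 → s (m * h) ≠ 0)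

theorem cubic_factor_a {a : ℂ} (ha : ∀ m : ℤ, s (a + m * h) ≠ 0) {N n j : ℕ} (hN : N = n + 2 * j) :
    s (a + 4 * j * h) / s a / shiftProd s (a + (N + 1) * h) h (2 * j) *
        shiftProd s (a + 3 * j * h) h j * shiftProd s (a + 4 * j * h + h) h n =
      shiftProd s (a + h) h N / (shiftProd s a (3 * h) j * shiftProd s (a + h) (3 * h) j *
        shiftProd s (a + 2 * h) (3 * h) j) := by
  have n1 : s a ≠ 0 := by simpa using ha 0
  have n2 : shiftProd s (a + (N + 1) * h) h (2 * j) ≠ 0 :=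
    shiftProd_lattice_ne_zero ha (m := N + 1) (j := 1) (by simp) (by simp) _
  have n3 : shiftProd s a h (3 * j) ≠ 0 :=
    shiftProd_lattice_ne_zero ha (m := 0) (j := 1) (by simp) (by simp) _
  have f1 : shiftProd s (a + h) h N * shiftProd s (a + (N + 1) * h) h (2 * j) =
      shiftProd s (a + h) h (4 * j) * shiftProd s (a + 4 * j * h + h) h n := by
    have e1 := shiftProd_add s (a + h) h N (2 * j)
    have e2 := shiftProd_add s (a + h) h (4 * j) n
    rw [show a + h + N * h = a + (N + 1) * h by ring] at e1
    rw [show a + h + (4 * j : ℕ) * h = a + 4 * j * h + h by push_cast; ring] at e2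
    rw [← e1, ← e2, hN]
    congr 1
    ring
  have f2 : s a * shiftProd s (a + h) h (4 * j) =
      shiftProd s a h (3 * j) * shiftProd s (a + 3 * j * h) h j * s (a + 4 * j * h) := by
    rw [← shiftProd_succ', shiftProd_succ, show 4 * j = 3 * j + j by ring, shiftProd_add]
    rw [show a + (3 * j : ℕ) * h = a + 3 * j * h by push_cast; ring,
      show a + (3 * j + j : ℕ) * h = a + 4 * j * h by push_cast; ring]
  rw [← shiftProd_trisect, eq_div_iff n3, div_div, div_mul_eq_mul_div, div_mul_eq_mul_div,
    div_mul_eq_mul_div, div_eq_iff (mul_ne_zero n1 n2)]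
  linear_combination -shiftProd s (a + 4 * j * h + h) h n * f2 - s a * f1

include hs

/-- After reflection the two numerator progressions join into one of length `3j`, which splits
modulo 3 into those of `q^(-n)`, `q^(1-n)`, `q^(2-n)`. -/
theorem cubic_factor_q (N j : ℕ) (hz : shiftProd s (3 * h) (3 * h) j ≠ 0) :
    shiftProd s (-(N * h)) h (2 * j) * shiftProd s ((N + 1 - 3 * j) * h) h j /
        shiftProd s (-(3 * j * h)) (3 * h) j =
      shiftProd s ((2 - N) * h) (3 * h) j * shiftProd s ((1 - N) * h) (3 * h) j *
        shiftProd s (-(N * h)) (3 * h) j / shiftProd s (3 * h) (3 * h) j := by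
  have f1 := shiftProd_reflect hs ((N + 1 - 3 * j) * h) h j
  have f2 := shiftProd_reflect hs (-(3 * j * h)) (3 * h) j
  rw [show -((N + 1 - 3 * j) * h + (j - 1) * h) = -(N * h) + (2 * j : ℕ) * h by
    push_cast; ring] at f1
  rw [show -(-(3 * j * h) + (j - 1) * (3 * h)) = 3 * h by ring] at f2
  have f3 := shiftProd_add s (-(N * h)) h (2 * j) j
  rw [show 2 * j + j = 3 * j by ring, shiftProd_trisect,
    show -(N * h) + h = (1 - N) * h by ring, show -(N * h) + 2 * h = (2 - N) * h by ring] at f3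
  have n1 : ((-1 : ℂ)) ^ j ≠ 0 := pow_ne_zero _ (by norm_num)
  rw [f1, f2, div_eq_div_iff (mul_ne_zero n1 hz) hz]
  linear_combination -(-1) ^ j * shiftProd s (3 * h) (3 * h) j * f3

theorem cubic_factor_b {a b c : ℂ} {N n j : ℕ} (hN : N = n + 2 * j)
    (hab : ∀ m : ℤ, s (a - b + m * h) ≠ 0) (hbc : b + c = 2 * a + (N + 1) * h) :
    shiftProd s (a + 4 * j * h + (2 - n) * h - (b + 3 * j * h)) (3 * h) n /
        shiftProd s (a + 4 * j * h + h - (b + 3 * j * h)) h n /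
        (shiftProd s (a + h - b) h j * shiftProd s (a + h - c) h j) =
      shiftProd s (a + (2 - N) * h - b) (3 * h) N / shiftProd s (a + h - b) h N /
        (shiftProd s (a + (2 - N) * h - b) (3 * h) j *
          shiftProd s (a + (2 - N) * h - c) (3 * h) j) := by
  have hNc : (N : ℂ) = n + 2 * j := by rw [hN]; push_cast; ring
  have hN' : N = j + n + j := by omega
  have hc : c = 2 * a + (N + 1) * h - b := by linear_combination hbc
  have f1 : shiftProd s (a + (2 - N) * h - b) (3 * h) N =
      shiftProd s (a + (2 - N) * h - b) (3 * h) j *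
        shiftProd s (a + 4 * j * h + (2 - n) * h - (b + 3 * j * h)) (3 * h) n *
        ((-1) ^ j * shiftProd s (a + (2 - N) * h - c) (3 * h) j) := by
    nth_rewrite 2 [hN']
    rw [shiftProd_add, shiftProd_add,
      shiftProd_reflect hs (a + (2 - N) * h - b + ((j + n : ℕ) : ℂ) * (3 * h))]
    rw [show a + (2 - N) * h - b + j * (3 * h) =
      a + 4 * j * h + (2 - n) * h - (b + 3 * j * h) by rw [hNc]; ring,
      show -(a + (2 - N) * h - b + ((j + n : ℕ) : ℂ) * (3 * h) + (j - 1) * (3 * h)) =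
        a + (2 - N) * h - c by rw [hc, hNc]; push_cast; ring]
  have f2 : shiftProd s (a + h - b) h N = shiftProd s (a + h - b) h j *
        shiftProd s (a + 4 * j * h + h - (b + 3 * j * h)) h n *
        ((-1) ^ j * shiftProd s (a + h - c) h j) := by
    rw [hN', shiftProd_add, shiftProd_add,
      shiftProd_reflect hs (a + h - b + ((j + n : ℕ) : ℂ) * h)]
    rw [show a + h - b + j * h = a + 4 * j * h + h - (b + 3 * j * h) by ring,
      show -(a + h - b + ((j + n : ℕ) : ℂ) * h + (j - 1) * h) =
        a + h - c by rw [hc, hNc]; push_cast; ring]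
  have n1 : shiftProd s (a + (2 - N) * h - b) (3 * h) j ≠ 0 :=
    shiftProd_lattice_ne_zero hab (m := 2 - N) (j := 3) (by push_cast; ring) (by simp) _
  have n2 : shiftProd s (a + (2 - N) * h - c) (3 * h) j ≠ 0 := by
    refine shiftProd_ne_zero fun i _ hz => hab (2 * N - 1 - 3 * i) ?_
    rw [show a - b + ((2 * N - 1 - 3 * i : ℤ) : ℂ) * h =
      -(a + (2 - N) * h - c + i * (3 * h)) by rw [hc]; push_cast; ring, hs.neg, hz, neg_zero]
  have n3 : ((-1 : ℂ)) ^ j ≠ 0 := pow_ne_zero _ (by norm_num)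
  rw [f1, f2]
  generalize shiftProd s (a + (2 - N) * h - b) (3 * h) j = A1 at *
  generalize shiftProd s (a + (2 - N) * h - c) (3 * h) j = A2 at *
  generalize (-1 : ℂ) ^ j = A3 at *
  clear f1 f2 hab
  field_simp

omit hs in
-- Source of the very-well-poised factor: the progression of step `3h` from `a - (N + 1) h` with `2j
-- + 1` terms is cut in two ways.
theorem cubic_factor_lattice {a : ℂ} (ha : ∀ m : ℤ, s (a + m * h) ≠ 0) {N n j : ℕ}
    (hN : N = n + 2 * j) :
    1 / (shiftProd s (a + (3 * j - N - 1) * h) (3 * h) j *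
        shiftProd s (a + 4 * j * h + (2 - n) * h) (3 * h) n) =
      s (a - (N + 1) * h + 6 * j * h) / s (a - (N + 1) * h) *
        shiftProd s (a - (N + 1) * h) (3 * h) j / shiftProd s (a + (2 - N) * h) (3 * h) N := by
  have hNc : (N : ℂ) = n + 2 * j := by rw [hN]; push_cast; ring
  have n1 : s (a - (N + 1) * h) ≠ 0 := by
    have := ha (-(N + 1))
    convert this using 2
    push_cast; ring
  have n2 : shiftProd s (a + (3 * j - N - 1) * h) (3 * h) j ≠ 0 :=
    shiftProd_lattice_ne_zero ha (m := 3 * j - N - 1) (j := 3) (by push_cast; ring) (by simp) _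
  have n3 : shiftProd s (a + 4 * j * h + (2 - n) * h) (3 * h) n ≠ 0 :=
    shiftProd_lattice_ne_zero ha (m := 4 * j + 2 - n) (j := 3) (by push_cast; ring) (by simp) _
  have n4 : shiftProd s (a + (2 - N) * h) (3 * h) N ≠ 0 :=
    shiftProd_lattice_ne_zero ha (m := 2 - N) (j := 3) (by push_cast; ring) (by simp) _
  have f1 : shiftProd s (a + (2 - N) * h) (3 * h) N =
      shiftProd s (a + (2 - N) * h) (3 * h) (2 * j) *
        shiftProd s (a + 4 * j * h + (2 - n) * h) (3 * h) n := by
    nth_rewrite 2 [hN]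
    rw [add_comm n, shiftProd_add]
    congr 2
    rw [hNc]; push_cast; ring
  have f2 : s (a - (N + 1) * h) * shiftProd s (a + (2 - N) * h) (3 * h) (2 * j) =
      shiftProd s (a - (N + 1) * h) (3 * h) j * shiftProd s (a + (3 * j - N - 1) * h) (3 * h) j *
        s (a - (N + 1) * h + 6 * j * h) := by
    have e := shiftProd_succ' s (a - (N + 1) * h) (3 * h) (2 * j)
    rw [show a - (N + 1) * h + 3 * h = a + (2 - N) * h by ring, shiftProd_succ, two_mul,
      shiftProd_add] at e
    rw [two_mul, ← e, show a - (N + 1) * h + j * (3 * h) = a + (3 * j - N - 1) * h by ring,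
      show a - (N + 1) * h + (j + j : ℕ) * (3 * h) = a - (N + 1) * h + 6 * j * h by
        push_cast; ring]
  rw [div_mul_eq_mul_div, div_div, div_eq_div_iff (mul_ne_zero n2 n3) (mul_ne_zero n1 n4), one_mul,
    f1]
  linear_combination shiftProd s (a + 4 * j * h + (2 - n) * h) (3 * h) n * f2

omit hs in
theorem cubic_factor_de {a d e : ℂ} {N : ℕ} (hd : ∀ m : ℤ, s (d + m * h) ≠ 0)
    (he : ∀ m : ℤ, s (e + m * h) ≠ 0) (hde : d + e = a + (N + 1) * h) (j : ℕ) :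
    s (d - (N + 1) * h) * s (e - (N + 1) * h) /
        (s (d + (3 * j - N - 1) * h) * s (e + (3 * j - N - 1) * h)) =
      shiftProd s (a - d) (3 * h) j * shiftProd s (a - e) (3 * h) j /
        (shiftProd s (d + (2 - N) * h) (3 * h) j * shiftProd s (e + (2 - N) * h) (3 * h) j) := by
  have n1 : s (d + (3 * j - N - 1) * h) ≠ 0 := by simpa using hd (3 * j - N - 1)
  have n2 : s (e + (3 * j - N - 1) * h) ≠ 0 := by simpa using he (3 * j - N - 1)
  have n3 : shiftProd s (d + (2 - N) * h) (3 * h) j ≠ 0 :=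
    shiftProd_lattice_ne_zero hd (m := 2 - N) (j := 3) (by push_cast; ring) (by simp) _
  have n4 : shiftProd s (e + (2 - N) * h) (3 * h) j ≠ 0 :=
    shiftProd_lattice_ne_zero he (m := 2 - N) (j := 3) (by push_cast; ring) (by simp) _
  have e1 := shiftProd_shift s (a - d) (3 * h) j
  have e2 := shiftProd_shift s (a - e) (3 * h) j
  have c1 : a - d = e - (N + 1) * h := by linear_combination -hde
  have c2 : a - e = d - (N + 1) * h := by linear_combination -hde
  rw [c1, show e - (N + 1) * h + j * (3 * h) = e + (3 * j - N - 1) * h by ring,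
    show e - (N + 1) * h + 3 * h = e + (2 - N) * h by ring] at e1
  rw [c2, show d - (N + 1) * h + j * (3 * h) = d + (3 * j - N - 1) * h by ring,
    show d - (N + 1) * h + 3 * h = d + (2 - N) * h by ring] at e2
  rw [c1, c2, div_eq_div_iff (mul_ne_zero n1 n2) (mul_ne_zero n3 n4)]
  linear_combination (-s (d - (N + 1) * h) * shiftProd s (d + (2 - N) * h) (3 * h) j) * e1
    - shiftProd s (e - (N + 1) * h) (3 * h) j * s (e + (3 * j - N - 1) * h) * e2

include hh

theorem cubic_factorization {a b c d e : ℂ} {N n j : ℕ} (hN : N = n + 2 * j)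
    (ha : ∀ m : ℤ, s (a + m * h) ≠ 0) (hab : ∀ m : ℤ, s (a - b + m * h) ≠ 0)
    (hd : ∀ m : ℤ, s (d + m * h) ≠ 0) (he : ∀ m : ℤ, s (e + m * h) ≠ 0)
    (hbc : b + c = 2 * a + (N + 1) * h) (hde : d + e = a + (N + 1) * h) :
    s (d - (N + 1) * h) * s (e - (N + 1) * h) /
        (s (d + (3 * j - N - 1) * h) * s (e + (3 * j - N - 1) * h)) *
      (cubicBase s h a b c N j * cubicPFHead s h a N j *
        cubicValue s h (a + 4 * j * h) (b + 3 * j * h) n) =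
      cubicValue s h a b N * cubicOmega s h a b c d e N j := by
  have fA := cubic_factor_a ha hN
  have fB := cubic_factor_q hs N j (shiftProd_multiples_ne_zero hh j)
  have fC := cubic_factor_b hs hN hab hbc
  have fD := cubic_factor_lattice ha hN
  rw [cubic_factor_de hd he hde]
  simp only [cubicBase, cubicPFHead, cubicValue, cubicOmega]
  trans (shiftProd s (a - d) (3 * h) j * shiftProd s (a - e) (3 * h) j /
        (shiftProd s (d + (2 - N) * h) (3 * h) j * shiftProd s (e + (2 - N) * h) (3 * h) j)) *
      (shiftProd s b (3 * h) j * shiftProd s c (3 * h) j) *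
      (s (a + 4 * j * h) / s a / shiftProd s (a + (N + 1) * h) h (2 * j) *
        shiftProd s (a + 3 * j * h) h j * shiftProd s (a + 4 * j * h + h) h n) *
      (shiftProd s (-(N * h)) h (2 * j) * shiftProd s ((N + 1 - 3 * j) * h) h j /
        shiftProd s (-(3 * j * h)) (3 * h) j) *
      (shiftProd s (a + 4 * j * h + (2 - n) * h - (b + 3 * j * h)) (3 * h) n /
        shiftProd s (a + 4 * j * h + h - (b + 3 * j * h)) h n /
        (shiftProd s (a + h - b) h j * shiftProd s (a + h - c) h j)) *
      (1 / (shiftProd s (a + (3 * j - N - 1) * h) (3 * h) j *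
        shiftProd s (a + 4 * j * h + (2 - n) * h) (3 * h) n))
  · ring
  · rw [fA, fB, fC, fD]
    ring

/-- The cubic transformation formula for generic parameters, in additive notation. -/
theorem cubic_transformation {a b c d e : ℂ} {n : ℕ}
    (ha : ∀ m : ℤ, s (a + m * h) ≠ 0) (hab : ∀ m : ℤ, s (a - b + m * h) ≠ 0)
    (hd : ∀ m : ℤ, s (d + m * h) ≠ 0) (he : ∀ m : ℤ, s (e + m * h) ≠ 0)
    (hbc : b + c = 2 * a + (n + 1) * h) (hde : d + e = a + (n + 1) * h) :
    ∑ k ∈ Finset.range (n / 2 + 1), cubicBase s h a b c n k * cubicDE s h a d e k =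
      cubicValue s h a b n * ∑ j ∈ Finset.range (n / 3 + 1), cubicOmega s h a b c d e n j := by
  set D : ℕ → ℂ := fun j => s (d - (n + 1) * h) * s (e - (n + 1) * h) /
        (s (d + (3 * j - n - 1) * h) * s (e + (3 * j - n - 1) * h)) with hD
  -- The double sum is put in the variables `j` and `i = k - j`, ready for the interchange of
  -- summations.
  have h1 : ∑ k ∈ Finset.range (n / 2 + 1), cubicBase s h a b c n k * cubicDE s h a d e k =
      ∑ k ∈ Finset.range (n / 2 + 1), ∑ j ∈ Finset.range (k + 1),
        (fun j i => cubicBase s h a b c n (j + i) * (cubicPF s h a n (j + i) j * D j))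
          j (k - j) := by
    refine Finset.sum_congr rfl fun k _ => ?_
    rw [cubicDE_eq_sum hs hh ha hd he hde, Finset.mul_sum]
    refine Finset.sum_congr rfl fun j hj => ?_
    rw [Finset.mem_range] at hj
    simp only [hD]
    rw [show j + (k - j) = k by omega]
  rw [h1, Finset.sum_range_diag_flip _
    (fun j i => cubicBase s h a b c n (j + i) * (cubicPF s h a n (j + i) j * D j)), Finset.mul_sum]
  have h2 : ∀ j ∈ Finset.range (n / 2 + 1), ∑ i ∈ Finset.range (n / 2 + 1 - j),
      cubicBase s h a b c n (j + i) * (cubicPF s h a n (j + i) j * D j) =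
      D j * (cubicBase s h a b c n j * cubicPFHead s h a n j *
        ∑ i ∈ Finset.range ((n - 2 * j) / 2 + 1),
          cubicBase s h (a + 4 * j * h) (b + 3 * j * h) (c + 3 * j * h) (n - 2 * j) i *
            cubicRest s h (a + 4 * j * h) (n - 2 * j) i) := by
    intro j hj
    rw [Finset.mem_range] at hj
    rw [show n / 2 + 1 - j = (n - 2 * j) / 2 + 1 by omega, Finset.mul_sum, Finset.mul_sum]
    refine Finset.sum_congr rfl fun i _ => ?_
    obtain ⟨m, rfl⟩ : ∃ m, n = m + 2 * j := ⟨n - 2 * j, by omega⟩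
    rw [Nat.add_sub_cancel, cubicBase_add ha, cubicPF_add]
    ring
  rw [Finset.sum_congr rfl h2]
  symm
  have hsub : Finset.range (n / 3 + 1) ⊆ Finset.range (n / 2 + 1) := by
    intro j hj
    rw [Finset.mem_range] at hj ⊢
    omega
  rw [← Finset.sum_subset hsub]
  · refine Finset.sum_congr rfl fun j hj => ?_
    rw [Finset.mem_range] at hj
    have hN : n = (n - 2 * j) + 2 * j := by omega
    have hNc : ((n - 2 * j : ℕ) : ℂ) = n - 2 * j := by
      rw [Nat.cast_sub (by omega)]; push_cast; ring
    rw [cubic_sum hs hh (a := a + 4 * j * h)]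
    · exact (cubic_factorization hs hh hN ha hab hd he hbc hde).symm
    · intro m
      have := ha (4 * j + m)
      convert this using 2
      push_cast; ring
    · intro m
      have := hab (j + m)
      convert this using 2
      push_cast; ring
    · rw [hNc]
      linear_combination hbc
  · intro j hj hj'
    rw [Finset.mem_range] at hj hj'
    rw [cubicPFHead_eq_zero hs a (by omega) (by omega)]
    ring

end Cubic

/-! ### From generic to arbitrary parameters by continuity -/

theorem continuous_shiftProd {s : ℂ → ℂ} (hs : Continuous s) {x g : ℝ → ℂ} (hx : Continuous x)
    (hg : Continuous g) (k : ℕ) : Continuous fun t => shiftProd s (x t) (g t) k := by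
  unfold shiftProd
  fun_prop

/-- The cubic transformation formula in additive notation. -/
theorem cubic_transformation_of_continuous {s : ℂ → ℂ} (hs : IsThetaLike s) (hc : Continuous s)
    (hz : {z | s z = 0}.Countable) {h a b c d e : ℂ} {n : ℕ}
    (hbc : c = 2 * a + (n + 1) * h - b) (hde : e = a + (n + 1) * h - d) (ha : s a ≠ 0)
    (hab : ∀ k ≤ n / 2, shiftProd s (a + h - b) h k * shiftProd s (a + h - c) h k ≠ 0)
    (han : ∀ k ≤ n / 2, shiftProd s (a + (n + 1) * h) h (2 * k) ≠ 0)
    (had : ∀ k ≤ n / 2, shiftProd s (a + 3 * h - d) (3 * h) k *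
      shiftProd s (a + 3 * h - e) (3 * h) k ≠ 0)
    (hP : shiftProd s (a + h - b) h n * shiftProd s (a + (2 - n) * h) (3 * h) n ≠ 0)
    (ha₁ : s (a - (n + 1) * h) ≠ 0)
    (hR : ∀ k ≤ n / 3, shiftProd s (3 * h) (3 * h) k *
      (shiftProd s (a + (2 - n) * h - b) (3 * h) k *
        shiftProd s (a + (2 - n) * h - c) (3 * h) k) *
      (shiftProd s (d + (2 - n) * h) (3 * h) k * shiftProd s (e + (2 - n) * h) (3 * h) k) *
      (shiftProd s a (3 * h) k * shiftProd s (a + h) (3 * h) k *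
        shiftProd s (a + 2 * h) (3 * h) k) ≠ 0) :
    ∑ k ∈ Finset.range (n / 2 + 1), cubicBase s h a b c n k * cubicDE s h a d e k =
      cubicValue s h a b n * ∑ j ∈ Finset.range (n / 3 + 1), cubicOmega s h a b c d e n j := by
  subst hbc hde
  -- `b` stays fixed, and `h, a, d` move with velocities `1, I, 2I`; `c` and `e` follow from the
  -- balancing conditions. The combinations `mh` (`m ≠ 0`), `a + mh`, `a - b + mh`, `d + mh`, `e +
  -- mh` then have velocities `m`, `I + m`, `I + m`, `2I + m`, `-I + n + 1 + m`, none of them zero,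
  -- so each is a zero of `s` for only countably many `t`.
  set η : ℝ → ℂ := fun t => h + t with hη
  set α : ℝ → ℂ := fun t => a + t * Complex.I with hα
  set δ : ℝ → ℂ := fun t => d + t * (2 * Complex.I) with hδ
  set γ : ℝ → ℂ := fun t => 2 * α t + (n + 1) * η t - b with hγ
  set ε : ℝ → ℂ := fun t => α t + (n + 1) * η t - δ t with hε
  have cη : Continuous η := by fun_prop
  have cα : Continuous α := by fun_prop
  have cδ : Continuous δ := by fun_prop
  have cγ : Continuous γ := by fun_prop
  have cε : Continuous ε := by fun_prop
  have zη : η 0 = h := by simp [hη]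
  have zα : α 0 = a := by simp [hα]
  have zδ : δ 0 = d := by simp [hδ]
  have zγ : γ 0 = 2 * a + (n + 1) * h - b := by simp only [hγ, zα, zη]
  have zε : ε 0 = a + (n + 1) * h - d := by simp only [hε, zα, zη, zδ]
  set F : ℝ → ℂ := fun t => ∑ k ∈ Finset.range (n / 2 + 1),
    cubicBase s (η t) (α t) b (γ t) n k * cubicDE s (η t) (α t) (δ t) (ε t) k with hF
  set G : ℝ → ℂ := fun t => cubicValue s (η t) (α t) b n * ∑ j ∈ Finset.range (n / 3 + 1),
    cubicOmega s (η t) (α t) b (γ t) (δ t) (ε t) n j with hG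
  have P : ∀ {x g : ℝ → ℂ}, Continuous x → Continuous g → ∀ k : ℕ,
      ContinuousAt (fun t => shiftProd s (x t) (g t) k) 0 := fun hx hg k =>
    (continuous_shiftProd hc hx hg k).continuousAt
  have S : ∀ {x : ℝ → ℂ}, Continuous x → ContinuousAt (fun t => s (x t)) 0 := fun hx =>
    (hc.comp hx).continuousAt
  have c3 : Continuous fun t => 3 * η t := by fun_prop
  have hFc : ContinuousAt F 0 := by
    refine tendsto_finsetSum _ fun k hk => ?_
    have hk' : k ≤ n / 2 := by rw [Finset.mem_range] at hk; omega
    refine ContinuousAt.mul (((S (by fun_prop)).div (S cα) ?_).mul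
      (((P (by fun_prop) c3 k).mul (P (by fun_prop) c3 k)).div
        ((P (by fun_prop) cη k).mul (P (by fun_prop) cη k)) ?_) |>.mul
      ((P (by fun_prop) cη _).div (P (by fun_prop) cη _) ?_))
      (((P cδ cη k).mul (P cε cη k)).div ((P (by fun_prop) c3 k).mul (P (by fun_prop) c3 k)) ?_)
    · simpa only [zα] using ha
    · simpa only [Pi.mul_apply, zα, zη, zδ, zγ, zε] using hab k hk'
    · simpa only [Pi.mul_apply, zα, zη, zδ, zγ, zε] using han k hk'
    · simpa only [Pi.mul_apply, zα, zη, zδ, zγ, zε] using had k hk'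
  have hGc : ContinuousAt G 0 := by
    refine ContinuousAt.mul (((P (by fun_prop) cη n).mul (P (by fun_prop) c3 n)).div
      ((P (by fun_prop) cη n).mul (P (by fun_prop) c3 n)) ?_)
      (tendsto_finsetSum _ fun k hk => ?_)
    · simpa only [Pi.mul_apply, zα, zη, zδ, zγ, zε] using hP
    · have hk' : k ≤ n / 3 := by rw [Finset.mem_range] at hk; omega
      refine ContinuousAt.mul ((S (by fun_prop)).div (S (by fun_prop)) ?_)
        (ContinuousAt.div
          ((((P (by fun_prop) c3 k).mul ((P (by fun_prop) c3 k).mul (P cγ c3 k))).mul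
            ((P (by fun_prop) c3 k).mul (P (by fun_prop) c3 k))).mul
            (((P (by fun_prop) c3 k).mul (P (by fun_prop) c3 k)).mul (P (by fun_prop) c3 k)))
          ((((P c3 c3 k).mul ((P (by fun_prop) c3 k).mul (P (by fun_prop) c3 k))).mul
            ((P (by fun_prop) c3 k).mul (P (by fun_prop) c3 k))).mul
            (((P cα c3 k).mul (P (by fun_prop) c3 k)).mul (P (by fun_prop) c3 k))) ?_)
      · simpa only [Pi.mul_apply, zα, zη, zδ, zγ, zε] using ha₁
      · simpa only [Pi.mul_apply, zα, zη, zδ, zγ, zε] using hR k hk'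
  have hbad : ∀ x v : ℂ, v ≠ 0 → {t : ℝ | s (x + t * v) = 0}.Countable := by
    intro x v hv
    refine hz.preimage (f := fun t : ℝ => x + t * v) fun t u htu => ?_
    have := mul_right_cancel₀ hv (add_left_cancel htu)
    exact_mod_cast this
  have hI : ∀ (m : ℤ) (r : ℝ), r ≠ 0 → (r * Complex.I + m : ℂ) ≠ 0 := by
    intro m r hr h0
    have := congrArg Complex.im h0
    simp at this
    exact hr this
  have hgood : ∀ x v : ℤ → ℂ, (∀ m, v m ≠ 0) →
      {t : ℝ | ∃ m, s (x m + t * v m) = 0}.Countable := by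
    intro x v hv
    rw [show {t : ℝ | ∃ m, s (x m + t * v m) = 0} = ⋃ m, {t : ℝ | s (x m + t * v m) = 0} by
      ext t; simp]
    exact Set.countable_iUnion fun m => hbad _ _ (hv m)
  set B : Set ℝ :=
    (⋃ m : {m : ℤ // m ≠ 0}, {t : ℝ | s ((m : ℤ) * h + t * ((m : ℤ) : ℂ)) = 0}) ∪
    ({t : ℝ | ∃ m : ℤ, s (a + m * h + t * ((1 : ℝ) * Complex.I + m)) = 0} ∪
    {t : ℝ | ∃ m : ℤ, s (a - b + m * h + t * ((1 : ℝ) * Complex.I + m)) = 0} ∪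
    {t : ℝ | ∃ m : ℤ, s (d + m * h + t * ((2 : ℝ) * Complex.I + m)) = 0} ∪
    {t : ℝ | ∃ m : ℤ, s (a + (n + 1) * h - d + m * h +
      t * (((-1 : ℝ) : ℂ) * Complex.I + (n + 1 + m : ℤ))) = 0}) with hB
  have hBc : B.Countable := by
    refine (Set.countable_iUnion fun m => hbad _ _ (by exact_mod_cast m.2)).union
      (((Set.Countable.union ?_ ?_).union ?_).union ?_)
    · exact hgood _ _ fun m => hI m 1 one_ne_zero
    · exact hgood _ _ fun m => hI m 1 one_ne_zero
    · exact hgood _ _ fun m => hI m 2 two_ne_zero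
    · exact hgood _ _ fun m => hI _ (-1) (by norm_num)
  have hFG : ∀ t ∉ B, F t = G t := by
    intro t ht
    simp only [hB, Set.mem_union, Set.mem_iUnion, Set.mem_ofPred_eq, not_or, not_exists] at ht
    obtain ⟨t1, ⟨⟨t2, t3⟩, t4⟩, t5⟩ := ht
    refine cubic_transformation hs (fun m hm hm0 => t1 ⟨m, hm⟩ ?_) (fun m hm => t2 m ?_)
      (fun m hm => t3 m ?_) (fun m hm => t4 m ?_) (fun m hm => t5 m ?_) ?_ ?_
    · rw [← hm0]; congr 1; simp only [hη]; ring
    · rw [← hm]; congr 1; simp only [hη, hα]; push_cast; ring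
    · rw [← hm]; congr 1; simp only [hη, hα]; push_cast; ring
    · rw [← hm]; congr 1; simp only [hη, hδ]; push_cast; ring
    · rw [← hm]; congr 1; simp only [hη, hα, hδ, hε]; push_cast; ring
    · simp only [hγ]; ring
    · simp only [hε]; ring
  have h0 : F 0 = G 0 := by
    by_contra hne
    have hev := (hFc.sub hGc).eventually_ne (sub_ne_zero.2 hne)
    obtain ⟨t, ht1, ht2⟩ := (hBc.dense_compl ℝ).inter_nhds_nonempty hev
    exact ht2 (sub_eq_zero.2 (hFG t ht1))
  simp only [hF, hG, zη, zα, zδ, zγ, zε] at h0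
  exact h0

/-! ### Return to multiplicative notation -/

/-- The exponential factor relating `ellFac` to `shiftProd`. -/
noncomputable def shiftExp (x g : ℂ) (k : ℕ) : ℂ :=
  Complex.exp (k * x / 2 + g * (k * (k - 1)) / 4)

theorem ellFac_exp (p x g : ℂ) (k : ℕ) : ellFac (Complex.exp x) (Complex.exp g) p k =
    shiftExp x g k * shiftProd (symTheta p) x g k := by
  induction k with
  | zero => simp [ellFac, shiftExp, shiftProd]
  | succ k ih =>
    have e : shiftExp x g (k + 1) = shiftExp x g k * Complex.exp ((x + k * g) / 2) := by
      rw [shiftExp, shiftExp, ← Complex.exp_add]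
      congr 1
      push_cast
      ring
    rw [ellFac, Finset.prod_range_succ, shiftProd_succ, e]
    change ellFac _ _ p k * _ = _
    rw [ih, ← Complex.exp_nat_mul, ← Complex.exp_add, ellE_exp]
    ring

theorem shiftProd_ne_zero_of_ellFac {p x g : ℂ} {k : ℕ}
    (h : ellFac (Complex.exp x) (Complex.exp g) p k ≠ 0) : shiftProd (symTheta p) x g k ≠ 0 := by
  rw [ellFac_exp] at h
  exact right_ne_zero_of_mul h

theorem symTheta_ne_zero_of_ellE {p x : ℂ} (h : ellE (Complex.exp x) p ≠ 0) :
    symTheta p x ≠ 0 := by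
  rw [ellE_exp] at h
  exact right_ne_zero_of_mul h

/-- The factor `q^k` and the two balancing conditions are what make the exponential prefactors
multiply to `1`. -/
theorem cubicBase_mul_cubicDE_symTheta (p : ℂ) {h a b c d e : ℂ} {n : ℕ}
    (hc : c = 2 * a + (n + 1) * h - b) (he : e = a + (n + 1) * h - d) (k : ℕ) :
    ellE (Complex.exp (a + 4 * k * h)) p / ellE (Complex.exp a) p *
      (ellFac (Complex.exp b) (Complex.exp (3 * h)) p k *
          ellFac (Complex.exp c) (Complex.exp (3 * h)) p k /
        (ellFac (Complex.exp (a + h - b)) (Complex.exp h) p k *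
          ellFac (Complex.exp (a + h - c)) (Complex.exp h) p k)) *
      (ellFac (Complex.exp (-(n * h))) (Complex.exp h) p (2 * k) /
        ellFac (Complex.exp (a + (n + 1) * h)) (Complex.exp h) p (2 * k)) *
      (ellFac (Complex.exp d) (Complex.exp h) p k * ellFac (Complex.exp e) (Complex.exp h) p k /
        (ellFac (Complex.exp (a + 3 * h - d)) (Complex.exp (3 * h)) p k *
          ellFac (Complex.exp (a + 3 * h - e)) (Complex.exp (3 * h)) p k)) *
      Complex.exp h ^ k =
    cubicBase (symTheta p) h a b c n k * cubicDE (symTheta p) h a d e k := by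
  simp only [ellE_exp, ellFac_exp]
  have hexp : Complex.exp ((a + 4 * k * h) / 2) / Complex.exp (a / 2) *
      (shiftExp b (3 * h) k * shiftExp c (3 * h) k /
        (shiftExp (a + h - b) h k * shiftExp (a + h - c) h k)) *
      (shiftExp (-(n * h)) h (2 * k) / shiftExp (a + (n + 1) * h) h (2 * k)) *
      (shiftExp d h k * shiftExp e h k /
        (shiftExp (a + 3 * h - d) (3 * h) k * shiftExp (a + 3 * h - e) (3 * h) k)) *
      Complex.exp h ^ k = 1 := by
    simp only [shiftExp, ← Complex.exp_add, ← Complex.exp_sub, ← Complex.exp_nat_mul]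
    refine Eq.trans (congrArg Complex.exp ?_) Complex.exp_zero
    rw [hc, he]
    push_cast
    ring
  rw [← one_mul (cubicBase _ _ _ _ _ _ _ * _)]
  conv_rhs => enter [1]; rw [← hexp]
  rw [cubicBase, cubicDE]
  generalize Complex.exp h ^ k = X
  ring

theorem cubicValue_symTheta (p h a b : ℂ) (n : ℕ) :
    ellFac (Complex.exp (a + h)) (Complex.exp h) p n *
        ellFac (Complex.exp (a + (2 - n) * h - b)) (Complex.exp (3 * h)) p n /
      (ellFac (Complex.exp (a + h - b)) (Complex.exp h) p n *
        ellFac (Complex.exp (a + (2 - n) * h)) (Complex.exp (3 * h)) p n) =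
    cubicValue (symTheta p) h a b n := by
  simp only [ellFac_exp]
  have hexp : shiftExp (a + h) h n * shiftExp (a + (2 - n) * h - b) (3 * h) n /
      (shiftExp (a + h - b) h n * shiftExp (a + (2 - n) * h) (3 * h) n) = 1 := by
    simp only [shiftExp, ← Complex.exp_add, ← Complex.exp_sub]
    refine Eq.trans (congrArg Complex.exp ?_) Complex.exp_zero
    ring
  rw [← one_mul (cubicValue _ _ _ _ _)]
  conv_rhs => enter [1]; rw [← hexp]
  rw [cubicValue]
  ring

theorem cubicOmega_symTheta (p : ℂ) {h a b c d e : ℂ} {n : ℕ}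
    (hc : c = 2 * a + (n + 1) * h - b) (he : e = a + (n + 1) * h - d) (k : ℕ) :
    ellE (Complex.exp (a - (n + 1) * h + 6 * k * h)) p / ellE (Complex.exp (a - (n + 1) * h)) p *
      (ellFac (Complex.exp (a - (n + 1) * h)) (Complex.exp (3 * h)) p k *
        (ellFac (Complex.exp b) (Complex.exp (3 * h)) p k *
        (ellFac (Complex.exp c) (Complex.exp (3 * h)) p k *
        (ellFac (Complex.exp (a - d)) (Complex.exp (3 * h)) p k *
        (ellFac (Complex.exp (a - e)) (Complex.exp (3 * h)) p k *
        (ellFac (Complex.exp ((2 - n) * h)) (Complex.exp (3 * h)) p k *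
        (ellFac (Complex.exp ((1 - n) * h)) (Complex.exp (3 * h)) p k *
        ellFac (Complex.exp (-(n * h))) (Complex.exp (3 * h)) p k)))))) *
      Complex.exp (3 * h) ^ k /
      (ellFac (Complex.exp (3 * h)) (Complex.exp (3 * h)) p k *
        (ellFac (Complex.exp (a + (2 - n) * h - b)) (Complex.exp (3 * h)) p k *
        (ellFac (Complex.exp (a + (2 - n) * h - c)) (Complex.exp (3 * h)) p k *
        (ellFac (Complex.exp (d + (2 - n) * h)) (Complex.exp (3 * h)) p k *
        (ellFac (Complex.exp (e + (2 - n) * h)) (Complex.exp (3 * h)) p k *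
        (ellFac (Complex.exp a) (Complex.exp (3 * h)) p k *
        (ellFac (Complex.exp (a + h)) (Complex.exp (3 * h)) p k *
        ellFac (Complex.exp (a + 2 * h)) (Complex.exp (3 * h)) p k)))))))) =
    cubicOmega (symTheta p) h a b c d e n k := by
  simp only [ellE_exp, ellFac_exp]
  have hexp : Complex.exp ((a - (n + 1) * h + 6 * k * h) / 2) /
        Complex.exp ((a - (n + 1) * h) / 2) *
      (shiftExp (a - (n + 1) * h) (3 * h) k * (shiftExp b (3 * h) k * shiftExp c (3 * h) k) *
        (shiftExp (a - d) (3 * h) k * shiftExp (a - e) (3 * h) k) *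
        (shiftExp ((2 - n) * h) (3 * h) k * shiftExp ((1 - n) * h) (3 * h) k *
          shiftExp (-(n * h)) (3 * h) k) * Complex.exp (3 * h) ^ k /
      (shiftExp (3 * h) (3 * h) k *
        (shiftExp (a + (2 - n) * h - b) (3 * h) k * shiftExp (a + (2 - n) * h - c) (3 * h) k) *
        (shiftExp (d + (2 - n) * h) (3 * h) k * shiftExp (e + (2 - n) * h) (3 * h) k) *
        (shiftExp a (3 * h) k * shiftExp (a + h) (3 * h) k *
          shiftExp (a + 2 * h) (3 * h) k))) = 1 := by
    simp only [shiftExp, ← Complex.exp_add, ← Complex.exp_sub, ← Complex.exp_nat_mul]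
    refine Eq.trans (congrArg Complex.exp ?_) Complex.exp_zero
    rw [hc, he]
    ring
  rw [← one_mul (cubicOmega _ _ _ _ _ _ _ _ _)]
  conv_rhs => enter [1]; rw [← hexp]
  rw [cubicOmega]
  generalize Complex.exp (3 * h) ^ k = X
  ring

theorem mainTheorem6 (n : ℕ) (p q a b c d e : ℂ)
    (hp : ‖p‖ < 1) (hq : q ≠ 0) (ha : a ≠ 0)
    (hbc : b * c = a ^ 2 * q ^ (n + 1)) (hde : d * e = a * q ^ (n + 1))
    -- no denominator on the left-hand side vanishes
    (hEa : ellE a p ≠ 0)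
    (hL : ∀ k ≤ n / 2,
      ellFacs [a * q / b, a * q / c] q p k ≠ 0 ∧
      ellFac (a * q ^ (n + 1)) q p (2 * k) ≠ 0 ∧
      ellFacs [a * q ^ 3 / d, a * q ^ 3 / e] (q ^ 3) p k ≠ 0)
    -- no denominator of the prefactor on the right-hand side vanishes
    (hP₁ : ellFac (a * q / b) q p n ≠ 0)
    (hP₂ : ellFac (a * q ^ (2 - n : ℤ)) (q ^ 3) p n ≠ 0)
    -- no denominator in the terminating series on the right-hand side vanishes
    (hEa₁ : ellE (a ^ 2 / (d * e)) p ≠ 0)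
    (hR : ∀ k ≤ n / 3,
      ellOmegaDen (a ^ 2 / (d * e))
        [b, c, a / d, a / e, q ^ (2 - n : ℤ), q ^ (1 - n : ℤ), q ^ (-n : ℤ)] (q ^ 3) p k ≠ 0) :
    ∑ k ∈ Finset.range (n / 2 + 1),
        ellE (a * q ^ (4 * k)) p / ellE a p *
          (ellFacs [b, c] (q ^ 3) p k / ellFacs [a * q / b, a * q / c] q p k) *
          (ellFac (q ^ (-n : ℤ)) q p (2 * k) / ellFac (a * q ^ (n + 1)) q p (2 * k)) *
          (ellFacs [d, e] q p k / ellFacs [a * q ^ 3 / d, a * q ^ 3 / e] (q ^ 3) p k) * q ^ k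
      = ellFac (a * q) q p n * ellFac (a * q ^ (2 - n : ℤ) / b) (q ^ 3) p n /
          (ellFac (a * q / b) q p n * ellFac (a * q ^ (2 - n : ℤ)) (q ^ 3) p n) *
        ellOmega (a ^ 2 / (d * e))
          [b, c, a / d, a / e, q ^ (2 - n : ℤ), q ^ (1 - n : ℤ), q ^ (-n : ℤ)] (q ^ 3) p := by
  have hb : b ≠ 0 := fun h0 => by
    rw [h0, zero_mul] at hbc
    exact mul_ne_zero (pow_ne_zero 2 ha) (pow_ne_zero _ hq) hbc.symm
  have hd : d ≠ 0 := fun h0 => by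
    rw [h0, zero_mul] at hde
    exact mul_ne_zero ha (pow_ne_zero _ hq) hde.symm
  obtain ⟨h, hqh⟩ : ∃ h, q = Complex.exp h := ⟨_, (Complex.exp_log hq).symm⟩
  obtain ⟨α, haα⟩ : ∃ x, a = Complex.exp x := ⟨_, (Complex.exp_log ha).symm⟩
  obtain ⟨β, hbβ⟩ : ∃ x, b = Complex.exp x := ⟨_, (Complex.exp_log hb).symm⟩
  obtain ⟨δ, hdδ⟩ : ∃ x, d = Complex.exp x := ⟨_, (Complex.exp_log hd).symm⟩
  -- The logarithms of `c` and `e` are defined by the balancing conditions rather than chosen, so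
  -- that these hold exactly and not merely modulo `2πi`.
  obtain ⟨γ, hγ⟩ : ∃ γ, γ = 2 * α + (n + 1) * h - β := ⟨_, rfl⟩
  obtain ⟨ε, hε⟩ : ∃ ε, ε = α + (n + 1) * h - δ := ⟨_, rfl⟩
  have hcγ : c = Complex.exp γ := by
    rw [hγ, Complex.exp_sub, ← hbβ, eq_div_iff hb, mul_comm c b, hbc, Complex.exp_add, haα, hqh,
      ← Complex.exp_nat_mul, ← Complex.exp_nat_mul]
    push_cast
    rfl
  have heε : e = Complex.exp ε := by
    rw [hε, Complex.exp_sub, ← hdδ, eq_div_iff hd, mul_comm e d, hde, Complex.exp_add, haα, hqh,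
      ← Complex.exp_nat_mul]
    push_cast
    rfl
  -- the arguments of all factorials, in additive notation
  have q3 : q ^ 3 = Complex.exp (3 * h) := by rw [hqh, ← Complex.exp_nat_mul]; push_cast; rfl
  have z2 : q ^ (2 - n : ℤ) = Complex.exp ((2 - n) * h) := by
    rw [hqh, ← Complex.exp_int_mul]; push_cast; rfl
  have z1 : q ^ (1 - n : ℤ) = Complex.exp ((1 - n) * h) := by
    rw [hqh, ← Complex.exp_int_mul]; push_cast; rfl
  have z0 : q ^ (-n : ℤ) = Complex.exp (-(n * h)) := by
    rw [hqh, ← Complex.exp_int_mul]; push_cast; rw [neg_mul]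
  have aq : a * q = Complex.exp (α + h) := by rw [haα, hqh, Complex.exp_add]
  have aqb : a * q / b = Complex.exp (α + h - β) := by rw [aq, hbβ, Complex.exp_sub]
  have aqc : a * q / c = Complex.exp (α + h - γ) := by rw [aq, hcγ, Complex.exp_sub]
  have aqn : a * q ^ (n + 1) = Complex.exp (α + (n + 1) * h) := by
    rw [haα, hqh, ← Complex.exp_nat_mul, ← Complex.exp_add]; push_cast; rfl
  have aq3d : a * q ^ 3 / d = Complex.exp (α + 3 * h - δ) := by
    rw [q3, haα, hdδ, Complex.exp_sub, Complex.exp_add]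
  have aq3e : a * q ^ 3 / e = Complex.exp (α + 3 * h - ε) := by
    rw [q3, haα, heε, Complex.exp_sub, Complex.exp_add]
  have aq4 : ∀ k : ℕ, a * q ^ (4 * k) = Complex.exp (α + 4 * k * h) := fun k => by
    rw [haα, hqh, ← Complex.exp_nat_mul, ← Complex.exp_add]; push_cast; rfl
  have az2 : a * q ^ (2 - n : ℤ) = Complex.exp (α + (2 - n) * h) := by
    rw [z2, haα, Complex.exp_add]
  have az2b : a * q ^ (2 - n : ℤ) / b = Complex.exp (α + (2 - n) * h - β) := by
    rw [az2, hbβ, Complex.exp_sub]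
  have a1 : a ^ 2 / (d * e) = Complex.exp (α - (n + 1) * h) := by
    rw [hde, aqn, haα, ← Complex.exp_nat_mul, ← Complex.exp_sub]
    congr 1
    push_cast
    ring
  have ad : a / d = Complex.exp (α - δ) := by rw [haα, hdδ, Complex.exp_sub]
  have ae : a / e = Complex.exp (α - ε) := by rw [haα, heε, Complex.exp_sub]
  have w : ∀ x y z : ℂ, x + 3 * h - y = z →
      Complex.exp x * Complex.exp (3 * h) / Complex.exp y = Complex.exp z := fun x y z hz => by
    rw [← hz, Complex.exp_sub, Complex.exp_add]
  have hden : ∀ k, ellOmegaDen (a ^ 2 / (d * e))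
      [b, c, a / d, a / e, q ^ (2 - n : ℤ), q ^ (1 - n : ℤ), q ^ (-n : ℤ)] (q ^ 3) p k =
      ellFac (Complex.exp (3 * h)) (Complex.exp (3 * h)) p k *
        (ellFac (Complex.exp (α + (2 - n) * h - β)) (Complex.exp (3 * h)) p k *
        (ellFac (Complex.exp (α + (2 - n) * h - γ)) (Complex.exp (3 * h)) p k *
        (ellFac (Complex.exp (δ + (2 - n) * h)) (Complex.exp (3 * h)) p k *
        (ellFac (Complex.exp (ε + (2 - n) * h)) (Complex.exp (3 * h)) p k *
        (ellFac (Complex.exp α) (Complex.exp (3 * h)) p k *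
        (ellFac (Complex.exp (α + h)) (Complex.exp (3 * h)) p k *
        ellFac (Complex.exp (α + 2 * h)) (Complex.exp (3 * h)) p k)))))) := by
    intro k
    simp only [ellOmegaDen, ellFacs, List.map_cons, List.map_nil, List.prod_cons, List.prod_nil,
      mul_one]
    rw [a1, ad, ae, z2, z1, z0, q3, hbβ, hcγ, w _ β (α + (2 - n) * h - β) (by ring),
      w _ γ (α + (2 - n) * h - γ) (by ring), w _ (α - δ) (δ + (2 - n) * h) (by ring),
      w _ (α - ε) (ε + (2 - n) * h) (by ring), w _ ((2 - n) * h) α (by ring),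
      w _ ((1 - n) * h) (α + h) (by ring), w _ (-(n * h)) (α + 2 * h) (by ring)]
  have hfacs : ∀ (x y g : ℂ) (k : ℕ), ellFacs [x, y] g p k = ellFac x g p k * ellFac y g p k :=
    fun x y g k => by simp [ellFacs]
  have hterm : ∀ k, ellOmegaTerm (a ^ 2 / (d * e))
      [b, c, a / d, a / e, q ^ (2 - n : ℤ), q ^ (1 - n : ℤ), q ^ (-n : ℤ)] (q ^ 3) p k =
      cubicOmega (symTheta p) h α β γ δ ε n k := by
    intro k
    rw [ellOmegaTerm, hden, ← cubicOmega_symTheta p hγ hε]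
    simp only [ellFacs, List.map_cons, List.map_nil, List.prod_cons, List.prod_nil, mul_one]
    rw [a1, ad, ae, z2, z1, z0, q3, hbβ, hcγ, ← Complex.exp_nat_mul, ← Complex.exp_add,
      show ((2 * k : ℕ) : ℂ) * (3 * h) = 6 * k * h by push_cast; ring]
  -- Exactly one of the exponents `-n`, `1 - n`, `2 - n` is divisible by 3, and it equals `-3 (n /
  -- 3)`; that parameter ends the series of base `q^3`.
  have hterminate : ∃ x ∈ [b, c, a / d, a / e, q ^ (2 - n : ℤ), q ^ (1 - n : ℤ), q ^ (-n : ℤ)],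
      x * (q ^ 3) ^ (n / 3) = 1 := by
    have hz : ∀ z : ℤ, z + 3 * (n / 3 : ℕ) = 0 → q ^ z * (q ^ 3) ^ (n / 3) = 1 := fun z hz => by
      rw [← pow_mul, ← zpow_natCast, ← zpow_add₀ hq]
      push_cast at hz ⊢
      rw [hz, zpow_zero]
    rcases (by omega : n % 3 = 0 ∨ n % 3 = 1 ∨ n % 3 = 2) with h3 | h3 | h3
    · exact ⟨q ^ (-n : ℤ), by simp, hz _ (by omega)⟩
    · exact ⟨q ^ (1 - n : ℤ), by simp, hz _ (by omega)⟩
    · exact ⟨q ^ (2 - n : ℤ), by simp, hz _ (by omega)⟩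
  obtain ⟨x, hx, hxm⟩ := hterminate
  have hLHS : ∀ k, ellE (a * q ^ (4 * k)) p / ellE a p *
      (ellFacs [b, c] (q ^ 3) p k / ellFacs [a * q / b, a * q / c] q p k) *
      (ellFac (q ^ (-n : ℤ)) q p (2 * k) / ellFac (a * q ^ (n + 1)) q p (2 * k)) *
      (ellFacs [d, e] q p k / ellFacs [a * q ^ 3 / d, a * q ^ 3 / e] (q ^ 3) p k) * q ^ k =
      cubicBase (symTheta p) h α β γ n k * cubicDE (symTheta p) h α δ ε k := by
    intro k
    rw [← cubicBase_mul_cubicDE_symTheta p hγ hε]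
    simp only [hfacs]
    rw [aq4, aqb, aqc, z0, aqn, aq3d, aq3e, q3, haα, hbβ, hcγ, hdδ, heε, hqh]
  rw [ellOmega_eq_sum_of_terminating _ _ _ _ x (n / 3) hx hxm,
    Finset.sum_congr rfl fun k _ => hLHS k, Finset.sum_congr rfl fun k _ => hterm k, aqb, az2b, az2,
    aq, q3, hqh, cubicValue_symTheta]
  rw [a1] at hEa₁
  rw [haα] at hEa
  rw [aqb, hqh] at hP₁
  rw [az2, q3] at hP₂
  refine cubic_transformation_of_continuous (isThetaLike_symTheta hp) (continuous_symTheta hp)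
    (countable_symTheta_zeros hp) hγ hε (symTheta_ne_zero_of_ellE hEa) (fun k hk => ?_)
    (fun k hk => ?_) (fun k hk => ?_)
    (mul_ne_zero (shiftProd_ne_zero_of_ellFac hP₁) (shiftProd_ne_zero_of_ellFac hP₂))
    (symTheta_ne_zero_of_ellE hEa₁) (fun k hk => ?_)
  · have := (hL k hk).1
    rw [hfacs, aqb, aqc, hqh] at this
    exact mul_ne_zero (shiftProd_ne_zero_of_ellFac (left_ne_zero_of_mul this))
      (shiftProd_ne_zero_of_ellFac (right_ne_zero_of_mul this))
  · have := (hL k hk).2.1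
    rw [aqn, hqh] at this
    exact shiftProd_ne_zero_of_ellFac this
  · have := (hL k hk).2.2
    rw [hfacs, aq3d, aq3e, q3] at this
    exact mul_ne_zero (shiftProd_ne_zero_of_ellFac (left_ne_zero_of_mul this))
      (shiftProd_ne_zero_of_ellFac (right_ne_zero_of_mul this))
  · have := hR k hk
    rw [hden] at this
    simp only [ellFac_exp, mul_ne_zero_iff] at this ⊢
    tauto
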